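/- **Setting.** Let $\mathcal P$ (processes) and $\Sigma$ (actions) be finite sets with a location function $\mathrm{dom}:\Sigma\to 2^{\mathcal P}\setminus\{\emptyset\}$ and a set $\Sigma^{env}\subseteq\Sigma$ of uncontrollable actions. An action $a$ is a $p$-action if $p\in\mathrm{dom}(a)$, and a local $p$-action if $\mathrm{dom}(a)=\{p\}$. Let $r\neq q$ be processes such that $r$ is a leaf with parent $q$ in the communication architecture: $\mathrm{dom}(a)\subseteq\{q,r\}$ for every $r$-action $a$. A *communication* of $r$ with $q$ is an action $a$ with $q,r\in\mathrm{dom}(a)$. A (deterministic) *Zielonka automaton* $\mathcal A$ consists of finite state sets $S_p$ ($p\in\mathcal P$), an initial state $s_{in}\in\prod_p S_p$ and, for every $a\in\Sigma$, a partial function $\delta_a$ from $\prod_{p\in\mathrm{dom}(a)}S_p$ to itself. An action $a$ changes the components in $\mathrm{dom}(a)$ of a global state according to $\delta_a$ and leaves the others unchanged. A run starts in $s_{in}$ and is determined by its label $x$, a finite or infinite word over $\Sigma$. The run on $x$ is *maximal* if there are no decomposition $x=yz$ and action $a$ such that no letter of $z$ shares a process with $a$ and the run on $yaz$ is defined. In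 the product $\mathcal A\times\mathcal C$ both automata move synchronously on every action. A *correctness condition* of $\mathcal A$ gives for each process $p$ a set $T_p\subseteq S_p$ and a set $\Omega_p\subseteq(S_p\times\Sigma\times S_p)^\omega$ (for example an $\omega$-regular one). A run satisfies it if for every $p$ the projection of the run on the $p$-transitions either is finite and ends in a $p$-state in $T_p$ (the initial $p$-state if there is no $p$-transition), or is infinite and belongs to $\Omega_p$. It is a *parity condition* on $r$, with rank function $\mathrm{rk}:S_r\to\mathbb N$, if $\Omega_r$ is the set of sequences in which the largest rank seen infinitely often is even. $\mathcal A$ is *$r$-aware* if the $r$-state reached by any finite run determines the largest rank of the $r$-states visited since the last communication of $r$ with $q$ (since the beginning of the run if there was none), the state just after that communication and the current state included. A *controller* is a Zielonka automaton $\mathcal C$ over the same alphabet for which $\delta_a$ is total for all $a\in\Sigma^{env}$; it is *correct* for $\mathcal A$ if all maximal runs of $\mathcal A\times\mathcal C$ satisfy the correctness condition of $\mathcal A$. A *covering controller* for $\mathcal A$ is a Zielonka automaton $\mathcal C$ over the same alphabet, with state sets $C_p$, together with maps $\pi:C_p\to S_p$ ($p\in\mathcal P$) such that $\pi$ maps the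 initial state of $\mathcal C$ to $s_{in}$ and transitions of $\mathcal C$ to transitions of $\mathcal A$ with the same action, and such that for each $a\in\Sigma^{env}$ and $c\in\prod_{p\in\mathrm{dom}(a)}C_p$, if $a$ is enabled in $\pi(c)$ then $a$ is enabled in $c$. It is *correct* if all maximal runs of $\mathcal C$ satisfy the condition of $\mathcal A$ after applying $\pi$. It is *$r$-memoryless* if for all $c_r\neq c'_r$ in $C_r$ such that there is a path from $c_r$ to $c'_r$ in $\mathcal C$ on local $r$-actions, $\pi(c_r)\neq\pi(c'_r)$. **Lemma.** Let $\mathcal A$ be a Zielonka automaton with a correctness condition that is a parity condition on $r$, and suppose that $\mathcal A$ is $r$-aware with respect to it. If there is a correct controller for $\mathcal A$, then there is a correct covering controller for $\mathcal A$ that is $r$-memoryless. -/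

import Mathlib

universe u v w

/-- A distributed action alphabet on the set `P` of processes: every action `a` has a nonempty
location `dom a`; `env` is the set of uncontrollable (environment) actions, and the remaining
actions are the controllable (system) ones. -/
structure DistAlphabet (P : Type v) (Act : Type w) where
  dom : Act → Set P
  dom_nonempty : ∀ a, (dom a).Nonempty
  env : Set Act

namespace DistAlphabet

variable {P : Type v} {Act : Type w} (D : DistAlphabet P Act)

/-- The communication architecture: processes are linked when they have a common action. -/
def commGraph : SimpleGraph P where
  Adj p p' := p ≠ p' ∧ ∃ a, p ∈ D.dom a ∧ p' ∈ D.dom a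
  symm := ⟨fun _ _ h => ⟨h.1.symm, h.2.imp fun _ ha => And.symm ha⟩⟩
  loopless := ⟨fun _ h => h.1 rfl⟩

/-- `r` is a leaf of the architecture with parent `q`: `q` is a process different from `r`, and
`r` has common actions with no process other than `q`. -/
def IsLeafOf (r q : P) : Prop := r ≠ q ∧ D.commGraph.neighborSet r ⊆ {q}

/-- `n` is the position of a letter of the (finite or infinite) word `x` that is a `p`-action. -/
def ActsAt (x : Stream'.Seq Act) (p : P) (n : ℕ) : Prop := ∃ a, x.get? n = some a ∧ p ∈ D.dom a

/-- The letter at position `n` is a communication between `r` and `q`. -/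
def CommAt (x : Stream'.Seq Act) (r q : P) (n : ℕ) : Prop :=
  ∃ a, x.get? n = some a ∧ r ∈ D.dom a ∧ q ∈ D.dom a

/-- The location of a word: the union of the locations of its letters. -/
def wordDom (x : Stream'.Seq Act) : Set P := {p | ∃ a ∈ x, p ∈ D.dom a}

end DistAlphabet

/-- A (deterministic, finite-state) Zielonka automaton; the transition function `δ a` is a partial
function on the tuples of states of the processes in the location of `a`. -/
structure ZielonkaAutomaton {P : Type v} {Act : Type w} (D : DistAlphabet P Act) where
  State : P → Type u
  finite_state : ∀ p, Finite (State p)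
  init : ∀ p, State p
  δ : ∀ a, (∀ p : D.dom a, State p) → Option (∀ p : D.dom a, State p)

namespace ZielonkaAutomaton

variable {P : Type v} {Act : Type w} {D : DistAlphabet P Act}

/-- Global states. -/
abbrev Global (A : ZielonkaAutomaton.{u} D) : Type _ := ∀ p, A.State p

/-- The global transition `s -a-> s'`. -/
def Step (A : ZielonkaAutomaton.{u} D) (s : A.Global) (a : Act) (s' : A.Global) : Prop :=
  A.δ a (fun p : D.dom a => s p) = some (fun p : D.dom a => s' p) ∧ ∀ p, p ∉ D.dom a → s' p = s p

/-- `σ` is the run on the finite or infinite word `x`: `σ n` is the global state after the first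
`n` letters (if `x` has fewer than `n` letters, it is the last state of the run). -/
def IsRun (A : ZielonkaAutomaton.{u} D) (x : Stream'.Seq Act) (σ : ℕ → A.Global) : Prop :=
  σ 0 = A.init ∧
    ∀ n, (∀ a, x.get? n = some a → A.Step (σ n) a (σ (n + 1))) ∧
      (x.get? n = none → σ (n + 1) = σ n)

/-- The run on the word `x` is defined. -/
def RunDefined (A : ZielonkaAutomaton.{u} D) (x : Stream'.Seq Act) : Prop := ∃ σ, A.IsRun x σ

/-- The run on the word `x` is maximal: there are no decomposition `x = y z` and no action `a`
with `dom z ∩ dom a = ∅` for which the run on `y a z` is defined. -/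
def IsMaximal (A : ZielonkaAutomaton.{u} D) (x : Stream'.Seq Act) : Prop :=
  ¬ ∃ (y : List Act) (z : Stream'.Seq Act) (a : Act),
    x = (Stream'.Seq.ofList y).append z ∧ D.wordDom z ∩ D.dom a = ∅ ∧
      A.RunDefined ((Stream'.Seq.ofList y).append (Stream'.Seq.cons a z))

/-- A local correctness condition: for each process `p`, a set of terminal states and a set of
infinite sequences of `p`-transitions. -/
structure Corr (A : ZielonkaAutomaton.{u} D) where
  term : ∀ p, Set (A.State p)
  inf : ∀ p, Set (ℕ → A.State p × Act × A.State p)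

/-- `t` is the infinite sequence of transitions of process `p` in the run with label `x` and
states `ρ`, where `e` lists the positions of the `p`-actions in increasing order. Such a `t` exists
exactly when `x` has infinitely many `p`-actions, and it is unique. -/
def IsProjection (A : ZielonkaAutomaton.{u} D) (x : Stream'.Seq Act) (ρ : ℕ → A.Global) (p : P)
    (t : ℕ → A.State p × Act × A.State p) : Prop :=
  ∃ e : ℕ → ℕ, StrictMono e ∧ Set.range e = {n | D.ActsAt x p n} ∧
    ∀ k, (t k).1 = ρ (e k) p ∧ x.get? (e k) = some (t k).2.1 ∧ (t k).2.2 = ρ (e k + 1) p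

/-- The run with label `x` and states `ρ` satisfies the correctness condition: for every process
`p`, if its projection on `p` is finite, then its last `p`-state is terminal, and if the projection
is infinite, then it belongs to the set of correct infinite sequences. -/
def Corr.Holds {A : ZielonkaAutomaton.{u} D} (K : A.Corr) (x : Stream'.Seq Act)
    (ρ : ℕ → A.Global) : Prop :=
  ∀ p, (∀ n, (∀ m, n ≤ m → ¬ D.ActsAt x p m) → ρ n p ∈ K.term p) ∧
    ∀ t, A.IsProjection x ρ p t → t ∈ K.inf p

/-- The correctness condition on `r` is the (max-)parity condition of the rank function `rank`
(together with the set of terminal states): the largest rank that is seen infinitely often is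
even. -/
def Corr.IsParity {A : ZielonkaAutomaton.{u} D} (K : A.Corr) (r : P) (rank : A.State r → ℕ) :
    Prop :=
  K.inf r = {t | ∃ m, Even m ∧ (∃ᶠ k in Filter.atTop, rank (t k).1 = m) ∧
    ∀ᶠ k in Filter.atTop, rank (t k).1 ≤ m}

/-- `A` is `r`-aware (`q` being the parent of `r`): the state of `r` determines the biggest rank
that `r` has seen since its last communication with `q` (since the beginning of the run, if there
was none). Here `l` is the time just after the last communication before time `n`. -/
def RAware (A : ZielonkaAutomaton.{u} D) (r q : P) (rank : A.State r → ℕ) : Prop :=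
  ∃ f : A.State r → ℕ, ∀ x σ, A.IsRun x σ → ∀ l n, l ≤ n →
    (l = 0 ∨ ∃ j, l = j + 1 ∧ D.CommAt x r q j) →
    (∀ j, l ≤ j → j < n → ¬ D.CommAt x r q j) →
    IsGreatest {k | ∃ m, l ≤ m ∧ m ≤ n ∧ rank (σ m r) = k} (f (σ n r))

/-- The synchronized product. -/
def prod (A C : ZielonkaAutomaton.{u} D) : ZielonkaAutomaton.{u} D where
  State p := A.State p × C.State p
  finite_state p :=
    have := A.finite_state p
    have := C.finite_state p
    inferInstance
  init p := (A.init p, C.init p)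
  δ a s := (A.δ a fun p => (s p).1).bind fun s' =>
    (C.δ a fun p => (s p).2).map fun c' => fun p : D.dom a => (s' p, c' p)

/-- A controller cannot block uncontrollable actions. -/
def IsController (C : ZielonkaAutomaton.{u} D) : Prop :=
  ∀ a ∈ D.env, ∀ c, (C.δ a c).isSome

/-- The controller `C` is correct for the plant `A` with correctness condition `K`: all maximal
runs of `A × C` satisfy the correctness condition of `A`. -/
def IsCorrectController (A : ZielonkaAutomaton.{u} D) (K : A.Corr)
    (C : ZielonkaAutomaton.{u} D) : Prop :=
  C.IsController ∧ ∀ x σ, (A.prod C).IsRun x σ → (A.prod C).IsMaximal x →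
    K.Holds x fun n p => (σ n p).1

/-- `C` is a covering controller for `A` by means of the projection `π`. -/
structure IsCovering (A C : ZielonkaAutomaton.{u} D) (π : ∀ p, C.State p → A.State p) : Prop where
  init : ∀ p, π p (C.init p) = A.init p
  step : ∀ a c c', C.δ a c = some c' → A.δ a (fun p : D.dom a => π p (c p)) =
    some fun p : D.dom a => π p (c' p)
  env : ∀ a ∈ D.env, ∀ c, (A.δ a fun p : D.dom a => π p (c p)).isSome → (C.δ a c).isSome

/-- `C` is a correct covering controller for `A`: it is covering, and all its maximal runs satisfy
the correctness condition inherited from `A` through `π`. -/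
def IsCorrectCovering (A : ZielonkaAutomaton.{u} D) (K : A.Corr) (C : ZielonkaAutomaton.{u} D)
    (π : ∀ p, C.State p → A.State p) : Prop :=
  IsCovering A C π ∧ ∀ x σ, C.IsRun x σ → C.IsMaximal x → K.Holds x fun n p => π p (σ n p)

/-- There is a transition from `c` to `c'` on a local `r`-action. -/
def LocalStep (C : ZielonkaAutomaton.{u} D) (r : P) (c c' : C.State r) : Prop :=
  ∃ (a : Act) (hr : r ∈ D.dom a), D.dom a = {r} ∧
    ∃ t t', C.δ a t = some t' ∧ t ⟨r, hr⟩ = c ∧ t' ⟨r, hr⟩ = c'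

/-- `C` with projection `π` is `r`-memoryless: distinct `r`-states of `C` that are connected by a
path on local `r`-actions have distinct projections. -/
def RMemoryless (A C : ZielonkaAutomaton.{u} D)
    (π : ∀ p, C.State p → A.State p) (r : P) : Prop :=
  ∀ c c' : C.State r, c ≠ c' → Relation.ReflTransGen (C.LocalStep r) c c' → π r c ≠ π r c'

end ZielonkaAutomaton

/-!
Start from any correct covering controller `C`, for instance the product of the plant with a correct
controller. The new controller lets `r` remember the state `b` it had just after its last
communication with `q`, and after each local step `r` moves to a representative `rep b c` of the
state `c` it has reached. The representative depends on `b` and on the plant state `π c` only, and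
it is reachable from `b` by local `r`-actions. As `b` is constant along local `r`-actions, the new
controller is `r`-memoryless; the point is to choose the representatives so that it stays correct.

The local transition graph of `r` in `C` is finite. If the infinite local paths from `b` satisfy the
parity condition, there is a parity progress measure on the states reachable from `b`
(`exists_progress_measure`), and taking in each fibre of `π` a state of least measure makes all
paths through representatives satisfy the parity condition, as in the positional determinacy of
parity games. This alone is not enough: representatives could produce an infinite local path where
`C` has none, and then `q` might wait forever for a communication that `C` guarantees. If there is
no infinite local path from `b`, the representatives are therefore chosen for the constant rank `1`,
for which the parity condition excludes infinite paths altogether (`exists_isPositional`).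

Correctness is shown by transforming a maximal run of the new controller into a maximal run of `C`
(`Simulation`): the other processes make the same moves, and each segment of local `r`-actions is
replaced by a local path of `C` that starts in the base state `b`. There are three cases.
* With infinitely many communications, each segment is replaced by a path to the representative in
  which the next communication takes place. Awareness guarantees that the largest rank of the
  segment, which is determined by its last state, does not change.
* If `r` acts only finitely often, its last segment is replaced by a path to its final state.
* If `r` acts infinitely often but communicates only finitely often, its last segment may be replaced
  by any infinite local path of `C`. Such a path exists by the choice of the representatives, and
  since all these paths lead to correct runs, they all satisfy the parity condition, hence so does
  the path through representatives.
-/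

open Filter Relation

/-! ### Parity conditions and positional choices in finite graphs -/

/-- The largest value that the sequence `s` takes infinitely often exists and is even. This value
is encoded as the least eventual upper bound of `s`, see `EvenLimsup.isLeast_iff`. -/
def EvenLimsup (s : ℕ → ℕ) : Prop := ∃ m, Even m ∧ IsLeast {m | ∀ᶠ n in atTop, s n ≤ m} m

namespace EvenLimsup

theorem congr {s t : ℕ → ℕ}
    (h : ∀ m, (∀ᶠ n in atTop, s n ≤ m) ↔ ∀ᶠ n in atTop, t n ≤ m) :
    EvenLimsup s ↔ EvenLimsup t := by
  unfold EvenLimsup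
  simp only [h]

theorem isLeast_iff {s : ℕ → ℕ} {m : ℕ} : IsLeast {m | ∀ᶠ n in atTop, s n ≤ m} m ↔
    (∃ᶠ n in atTop, s n = m) ∧ ∀ᶠ n in atTop, s n ≤ m := by
  constructor
  · rintro ⟨h1, h2⟩
    refine ⟨fun h => ?_, h1⟩
    have h3 : ∀ᶠ n in atTop, s n < m := by
      filter_upwards [h, h1] with n hn hn' using lt_of_le_of_ne hn' hn
    have h4 : m ≤ m - 1 := h2 (by
      change ∀ᶠ n in atTop, s n ≤ m - 1
      filter_upwards [h3] with n hn
      omega)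
    obtain ⟨n, hn⟩ := h3.exists
    omega
  · rintro ⟨h1, h2⟩
    refine ⟨h2, fun k hk => ?_⟩
    obtain ⟨n, hn, hn'⟩ := (h1.and_eventually hk).exists
    omega

theorem comp_iff {s φ : ℕ → ℕ} (hφ : map φ atTop = atTop) :
    EvenLimsup (fun n => s (φ n)) ↔ EvenLimsup s :=
  congr fun m => by
    conv_rhs => rw [← hφ]
    rw [eventually_map]

theorem shift_iff (s : ℕ → ℕ) (k : ℕ) : EvenLimsup (fun n => s (n + k)) ↔ EvenLimsup s :=
  comp_iff (map_add_atTop_eq_nat k)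

end EvenLimsup

section Positional

variable {V : Type*}

/-- A closed walk can be repeated forever. -/
theorem exists_periodic_path {E : V → V → Prop} {v : V} (h : TransGen E v v) :
    ∃ u : ℕ → V, u 0 = v ∧ (∀ n, E (u n) (u (n + 1))) ∧ ∃ᶠ n in atTop, u n = v := by
  have key : ∀ w, TransGen E v w → ∃ (n : ℕ) (f : ℕ → V), 0 < n ∧ f 0 = v ∧ f n = w ∧
      ∀ i < n, E (f i) (f (i + 1)) := by
    intro w hw
    induction hw with
    | single h => exact ⟨1, fun i => if i = 0 then v else _, by simp, by simp, by simp; rfl,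
        fun i hi => by obtain rfl : i = 0 := by omega
                       simpa using h⟩
    | @tail b c _ hbc ih =>
      obtain ⟨n, f, hn, h0, hfn, hf⟩ := ih
      refine ⟨n + 1, fun i => if i ≤ n then f i else c, by omega, by simp [h0], by simp, ?_⟩
      intro i hi
      rcases Nat.lt_or_ge i n with h | h
      · simpa [h.le, Nat.succ_le_of_lt h] using hf i h
      · obtain rfl : i = n := by omega
        simpa [hfn] using hbc
  obtain ⟨n, f, hn, h0, hfn, hf⟩ := key v h
  refine ⟨fun i => f (i % n), by simpa using h0, fun i => ?_, ?_⟩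
  · have hlt := Nat.mod_lt i hn
    have := hf _ hlt
    rcases Nat.lt_or_ge (i % n + 1) n with h | h
    · have h2 : (i + 1) % n = i % n + 1 := by
        rw [Nat.add_mod, Nat.mod_eq_of_lt (a := 1) (by omega), Nat.mod_eq_of_lt h]
      simpa [h2] using this
    · have h3 : i % n + 1 = n := by omega
      have h2 : (i + 1) % n = 0 := by
        rw [← Nat.mod_add_mod, h3, Nat.mod_self]
      simp only [h2, h0]
      rwa [h3, hfn] at this
  · rw [frequently_atTop]
    exact fun a => ⟨a * n, Nat.le_mul_of_pos_right a hn, by simp [h0]⟩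

/-- If all infinite paths from `b` satisfy the parity condition, then so do all cycles that can be
reached from `b`. -/
theorem not_transGen_of_odd {E : V → V → Prop} {b : V} {rk : V → ℕ}
    (H : ∀ u : ℕ → V, u 0 = b → (∀ n, E (u n) (u (n + 1))) → EvenLimsup fun n => rk (u n))
    {v : V} (hv : ReflTransGen E b v) (hodd : Odd (rk v)) :
    ¬ TransGen (fun x y => rk x ≤ rk v ∧ E x y) v v := by
  intro h
  obtain ⟨u, hu0, hu, hfr⟩ := exists_periodic_path h
  have H' : ∀ u : ℕ → V, u 0 = v → (∀ n, E (u n) (u (n + 1))) → EvenLimsup fun n => rk (u n) := by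
    induction hv using ReflTransGen.head_induction_on with
    | refl => exact H
    | @head a c hac _ ih =>
      refine ih fun u h0 hu => ?_
      have := H (fun n => Nat.casesOn n a u) rfl (by
        intro n
        cases n with
        | zero => simpa [h0] using hac
        | succ n => exact hu n)
      exact (EvenLimsup.shift_iff _ 1).2 this
  obtain ⟨m, hm, hl⟩ := H' u hu0 fun n => (hu n).2
  have : IsLeast {m | ∀ᶠ n in atTop, rk (u n) ≤ m} (rk v) :=
    EvenLimsup.isLeast_iff.2 ⟨hfr.mono fun n hn => by rw [hn], .of_forall fun n => (hu n).1⟩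
  rw [hl.unique this] at hm
  exact (Nat.not_even_iff_odd.2 hodd) hm

/-- Parity progress measures: in a finite graph without cycles of odd maximal rank there are
measures `M k`, each one a coarsening of `M j` for `j ≤ k`, such that `M (rk v)` does not increase
along the edges that leave `v`, and decreases if the rank of `v` is odd. -/
theorem exists_progress_measure [Finite V] (E : V → V → Prop) (rk : V → ℕ)
    (hE : ∀ v, Odd (rk v) → ¬ TransGen (fun x y => rk x ≤ rk v ∧ E x y) v v) :
    ∃ M : ℕ → V → ℕ, (∀ j k, j ≤ k → ∀ v w, M j v ≤ M j w → M k v ≤ M k w) ∧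
      (∀ v w, E v w → M (rk v) w ≤ M (rk v) v) ∧
      ∀ v w, E v w → Odd (rk v) → M (rk v) w < M (rk v) v := by
  classical
  -- For odd `k`, `R k v` collects the vertices of rank `k` that are reachable from `v` through
  -- ranks `≤ k`. It shrinks along edges, strictly so from a vertex of rank `k`, which would
  -- otherwise lie on a cycle.
  let R : ℕ → V → Set V := fun k v =>
    {x | Odd k ∧ rk x = k ∧ ReflTransGen (fun x y => rk x ≤ k ∧ E x y) v x}
  let B := Nat.card V + 1
  have hRB : ∀ k v, (R k v).ncard < B := fun k v =>
    Nat.lt_succ_of_le (Set.ncard_le_card _)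
  have hR : ∀ k v w, rk v ≤ k → E v w → R k w ⊆ R k v := fun k v w hk h x hx =>
    ⟨hx.1, hx.2.1, ReflTransGen.head ⟨hk, h⟩ hx.2.2⟩
  have hR' : ∀ v w, E v w → Odd (rk v) → R (rk v) w ⊂ R (rk v) v := fun v w h ho =>
    (Set.ssubset_iff_of_subset (hR _ v w le_rfl h)).2
      ⟨v, ⟨ho, rfl, .refl⟩, fun hv => hE v ho (TransGen.head' ⟨le_rfl, h⟩ hv.2.2)⟩
  obtain ⟨N, hN⟩ : ∃ N, ∀ v, rk v < N := by
    obtain ⟨N, hN⟩ := (Set.finite_range rk).bddAbove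
    exact ⟨N + 1, fun v => Nat.lt_succ_of_le (hN ⟨v, rfl⟩)⟩
  -- The cardinalities of the sets `R j v`, `k ≤ j < N`, are the digits of `M k v` in base `B`.
  let T : ℕ → V → ℕ := fun i v =>
    Nat.rec 0 (fun i t => t * B + (R (N - 1 - i) v).ncard) i
  have hT : ∀ i v, T (i + 1) v = T i v * B + (R (N - 1 - i) v).ncard := fun i v => rfl
  have hTstep : ∀ i v w, T (i + 1) v ≤ T (i + 1) w → T i v ≤ T i w := by
    intro i v w h
    rw [hT, hT] at h
    by_contra! hlt
    have := hRB (N - 1 - i) w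
    have : (T i w + 1) * B ≤ T i v * B := Nat.mul_le_mul_right _ hlt
    rw [add_mul] at this
    omega
  have hTmono : ∀ i j, i ≤ j → ∀ v w, T j v ≤ T j w → T i v ≤ T i w := by
    intro i j hij v w
    induction hij with
    | refl => exact id
    | step _ ih => exact fun h => ih (hTstep _ _ _ h)
  have hTE : ∀ i v w, i ≤ N - rk v → E v w → T i w ≤ T i v := by
    intro i
    induction i with
    | zero => exact fun _ _ _ _ => le_rfl
    | succ i ih =>
      intro v w hi h
      rw [hT, hT]
      exact Nat.add_le_add (Nat.mul_le_mul_right _ (ih v w (by omega) h))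
        (Set.ncard_le_ncard (hR _ v w (by omega) h) (Set.toFinite _))
  refine ⟨fun k => T (N - k), fun j k hjk => hTmono _ _ (by omega),
    fun v w h => hTE _ v w le_rfl h, fun v w h ho => ?_⟩
  have hv := hN v
  obtain ⟨i, hi⟩ : ∃ i, N - rk v = i + 1 := ⟨N - rk v - 1, by omega⟩
  change T (N - rk v) w < T (N - rk v) v
  rw [hi, hT, hT]
  have h1 : N - 1 - i = rk v := by omega
  rw [h1]
  exact Nat.add_lt_add_of_le_of_lt (Nat.mul_le_mul_right _ (hTE i v w (by omega) h))
    (Set.ncard_lt_ncard (hR' v w h ho) (Set.toFinite _))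

/-- Choosing in each fibre of `π` the vertex of least progress measure yields a memoryless
strategy: all paths that jump to the representative after each step satisfy the parity
condition. -/
theorem exists_representatives_of_parity [Finite V] {S : Type*} (E : V → V → Prop) (π : V → S)
    (b : V) (rk : V → ℕ)
    (H : ∀ u : ℕ → V, u 0 = b → (∀ n, E (u n) (u (n + 1))) → EvenLimsup fun n => rk (u n)) :
    ∃ g : V → V, (∀ v, π (g v) = π v) ∧ (∀ v w, π v = π w → g v = g w) ∧
      (∀ v, ReflTransGen E b v → ReflTransGen E b (g v)) ∧
      ∀ u : ℕ → V, ReflTransGen E b (u 0) → (∀ n, ∃ v, E (u n) v ∧ u (n + 1) = g v) →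
        EvenLimsup fun n => rk (u n) := by
  obtain ⟨M, hM1, hM2, hM3⟩ := exists_progress_measure
    (fun v w => ReflTransGen E b v ∧ E v w) rk (by
      intro v ho h
      have hb : ReflTransGen E b v := by
        obtain ⟨y, ⟨_, hy, _⟩, _⟩ := TransGen.head'_iff.1 h
        exact hy
      exact not_transGen_of_odd H hb ho (h.lift id fun x y h => ⟨h.1, h.2.2⟩))
  -- If the fibre over `s` has no vertex that is reachable from `b`, then any vertex of it will do.
  have hex : ∀ s, (∃ v, π v = s) → ∃ w, π w = s ∧
      ((∃ v, π v = s ∧ ReflTransGen E b v) → ReflTransGen E b w) ∧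
      ∀ v, π v = s → ReflTransGen E b v → M 0 w ≤ M 0 v := by
    rintro s ⟨v, hv⟩
    by_cases h : ∃ v, π v = s ∧ ReflTransGen E b v
    · obtain ⟨w, hw, hmin⟩ := Set.exists_min_image {v | π v = s ∧ ReflTransGen E b v} (M 0)
        (Set.toFinite _) h
      exact ⟨w, hw.1, fun _ => hw.2, fun v h1 h2 => hmin v ⟨h1, h2⟩⟩
    · exact ⟨v, hv, fun h' => absurd h' h, fun v h1 h2 => absurd ⟨v, h1, h2⟩ h⟩
  choose G hG1 hG2 hG3 using hex
  have hcongr : ∀ s t (_ : s = t) hs ht, G s hs = G t ht := by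
    rintro s _ rfl _ _
    rfl
  refine ⟨fun v => G (π v) ⟨v, rfl⟩, fun v => hG1 _ _, fun v w h => hcongr _ _ h _ _,
    fun v hv => hG2 _ _ ⟨v, rfl, hv⟩, fun u hu0 hu => ?_⟩
  have hreach : ∀ n, ReflTransGen E b (u n) := by
    intro n
    induction n with
    | zero => exact hu0
    | succ n ih =>
      obtain ⟨v, hv, h⟩ := hu n
      rw [h]
      exact hG2 _ _ ⟨v, rfl, ih.tail hv⟩
  have hstep : ∀ n, ∃ v, E (u n) v ∧ M 0 (u (n + 1)) ≤ M 0 v := by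
    intro n
    obtain ⟨v, hv, h⟩ := hu n
    exact ⟨v, hv, by rw [h]; exact hG3 _ _ v rfl ((hreach n).tail hv)⟩
  obtain ⟨m, hm⟩ : ∃ m, IsLeast {m | ∀ᶠ n in atTop, rk (u n) ≤ m} m := by
    classical
    have hne : ∃ m, ∀ᶠ n in atTop, rk (u n) ≤ m := by
      obtain ⟨N, hN⟩ := (Set.finite_range rk).bddAbove
      exact ⟨N, .of_forall fun n => hN ⟨_, rfl⟩⟩
    exact ⟨Nat.find hne, Nat.find_spec hne, fun k hk => Nat.find_min' hne hk⟩
  refine ⟨m, ?_, hm⟩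
  by_contra hodd
  rw [Nat.not_even_iff_odd] at hodd
  obtain ⟨hfr, hev⟩ := EvenLimsup.isLeast_iff.1 hm
  obtain ⟨N, hN⟩ := eventually_atTop.1 hev
  -- For odd `m`, `M m` would be nonincreasing from time `N` on and decrease infinitely often.
  have hle : ∀ n, N ≤ n → M m (u (n + 1)) ≤ M m (u n) := by
    intro n hn
    obtain ⟨v, hv, h⟩ := hstep n
    exact (hM1 0 m (Nat.zero_le _) _ _ h).trans
      (hM1 _ m (hN n hn) _ _ (hM2 _ _ ⟨hreach n, hv⟩))
  have hlt : ∀ n, rk (u n) = m → M m (u (n + 1)) < M m (u n) := by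
    intro n hn
    obtain ⟨v, hv, h⟩ := hstep n
    refine (hM1 0 m (Nat.zero_le _) _ _ h).trans_lt ?_
    have := hM3 _ _ ⟨hreach n, hv⟩ (hn ▸ hodd)
    rwa [hn] at this
  obtain ⟨K, hK⟩ := WellFoundedGT.monotone_chain_condition
    (α := ℕᵒᵈ) ⟨fun n => OrderDual.toDual (M m (u (N + n))),
      monotone_nat_of_le_succ fun n => hle (N + n) (by omega)⟩
  obtain ⟨n, hn, hnm⟩ := frequently_atTop.1 hfr (N + K)
  have h1 := hK (n - N) (by omega)
  have h2 := hK (n + 1 - N) (by omega)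
  have h3 : M m (u (n + 1)) = M m (u n) := by
    have e1 : N + (n - N) = n := by omega
    have e2 : N + (n + 1 - N) = n + 1 := by omega
    simp only [OrderHom.coe_mk, e1, e2] at h1 h2
    exact h2.symm.trans h1
  exact absurd (hlt n hnm) (by rw [h3]; exact lt_irrefl _)

/-- `g` chooses representatives of the fibres of `π` in such a way that the paths that jump to the
representative after each step inherit from the paths of the graph that start in `b` both their
finiteness and the parity condition. -/
structure IsPositional {S : Type*} (E : V → V → Prop) (π : V → S) (b : V) (rk : S → ℕ)
    (g : V → V) : Prop where
  map_eq : ∀ v, π (g v) = π v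
  congr : ∀ v w, π v = π w → g v = g w
  reach : ∀ v, ReflTransGen E b v → ReflTransGen E b (g v)
  exists_path : ∀ u : ℕ → V, ReflTransGen E b (u 0) → (∀ n, ∃ v, E (u n) v ∧ u (n + 1) = g v) →
    ∃ u' : ℕ → V, u' 0 = b ∧ ∀ n, E (u' n) (u' (n + 1))
  evenLimsup : ∀ u : ℕ → V, ReflTransGen E b (u 0) → (∀ n, ∃ v, E (u n) v ∧ u (n + 1) = g v) →
    (∀ u' : ℕ → V, u' 0 = b → (∀ n, E (u' n) (u' (n + 1))) →
      EvenLimsup fun n => rk (π (u' n))) → EvenLimsup fun n => rk (π (u n))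

theorem exists_isPositional [Finite V] {S : Type*} (E : V → V → Prop) (π : V → S)
    (b : V) (rk : S → ℕ) : ∃ g : V → V, IsPositional E π b rk g := by
  by_cases hinf : ∃ u' : ℕ → V, u' 0 = b ∧ ∀ n, E (u' n) (u' (n + 1))
  · by_cases H : ∀ u' : ℕ → V, u' 0 = b → (∀ n, E (u' n) (u' (n + 1))) →
        EvenLimsup fun n => rk (π (u' n))
    · obtain ⟨g, h1, h2, h3, h4⟩ := exists_representatives_of_parity E π b (fun v => rk (π v)) H
      exact ⟨g, h1, h2, h3, fun _ _ _ => hinf, fun u hu0 hu _ => h4 u hu0 hu⟩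
    · obtain ⟨g, h1, h2, h3, -⟩ := exists_representatives_of_parity E π b (fun _ => 0)
        fun u _ _ => ⟨0, Even.zero, by simp⟩
      exact ⟨g, h1, h2, h3, fun _ _ _ => hinf, fun _ _ _ h => absurd h H⟩
  · -- With the constant rank `1` the parity condition says that there are no infinite paths.
    obtain ⟨g, h1, h2, h3, h4⟩ := exists_representatives_of_parity E π b (fun _ => 1)
      fun u hu0 hu => absurd ⟨u, hu0, hu⟩ hinf
    have hno : ∀ u : ℕ → V, ReflTransGen E b (u 0) →
        ¬ ∀ n, ∃ v, E (u n) v ∧ u (n + 1) = g v := by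
      intro u hu0 hu
      obtain ⟨m, hm, hl⟩ := h4 u hu0 hu
      have : IsLeast {m | ∀ᶠ n : ℕ in atTop, 1 ≤ m} 1 := 
        ⟨by simp, fun k hk => (Eventually.exists hk).choose_spec⟩
      rw [hl.unique this] at hm
      exact absurd hm (by decide)
    exact ⟨g, h1, h2, h3, fun u hu0 hu => absurd hu (hno u hu0),
      fun u hu0 hu => absurd hu (hno u hu0)⟩

end Positional

/-! ### Runs of Zielonka automata -/

namespace ZielonkaAutomaton

variable {P : Type v} {Act : Type w} {D : DistAlphabet P Act}

section Runs

variable {C : ZielonkaAutomaton.{u} D}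

theorem Step.unique {s : C.Global} {a : Act} {s₁ s₂ : C.Global} (h₁ : C.Step s a s₁)
    (h₂ : C.Step s a s₂) : s₁ = s₂ := by
  funext p
  by_cases hp : p ∈ D.dom a
  · have := h₁.1.symm.trans h₂.1
    exact congrFun (Option.some.inj this) ⟨p, hp⟩
  · rw [h₁.2 p hp, h₂.2 p hp]

/-- Whether an action is enabled, and its effect, depend on the states of its location only. -/
theorem Step.exists_of_eqOn {s s₁ t : C.Global} {a : Act} (h : C.Step s a s₁)
    (hst : ∀ p ∈ D.dom a, t p = s p) :
    ∃ t₁, C.Step t a t₁ ∧ (∀ p ∈ D.dom a, t₁ p = s₁ p) ∧ ∀ p ∉ D.dom a, t₁ p = t p := by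
  classical
  refine ⟨fun p => if p ∈ D.dom a then s₁ p else t p, ⟨?_, fun p hp => by simp [hp]⟩,
    fun p hp => by simp [hp], fun p hp => by simp [hp]⟩
  have e1 : (fun p : D.dom a => t p) = fun p : D.dom a => s p := funext fun p => hst p p.2
  have e2 : (fun p : D.dom a => if (p : P) ∈ D.dom a then s₁ p else t p) =
      fun p : D.dom a => s₁ p := funext fun p => by simp
  rw [e1, e2]
  exact h.1

theorem exists_step_of_isSome {s : C.Global} {a : Act}
    (h : (C.δ a fun p : D.dom a => s p).isSome) : ∃ s', C.Step s a s' := by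
  classical
  obtain ⟨t, ht⟩ := Option.isSome_iff_exists.1 h
  refine ⟨fun p => if hp : p ∈ D.dom a then t ⟨p, hp⟩ else s p, ?_, fun p hp => by simp [hp]⟩
  rw [ht]
  congr 1
  funext p
  simp

theorem IsRun.unique_upto {x x' : Stream'.Seq Act} {σ σ' : ℕ → C.Global} {n : ℕ}
    (h : C.IsRun x σ) (h' : C.IsRun x' σ') (hx : ∀ i < n, x.get? i = x'.get? i) :
    ∀ i ≤ n, σ i = σ' i := by
  intro i
  induction i with
  | zero => exact fun _ => h.1.trans h'.1.symm
  | succ i ih =>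
    intro hi
    have e := ih (by omega)
    have hx := hx i (by omega)
    cases hxi : x.get? i with
    | none => rw [(h.2 i).2 hxi, (h'.2 i).2 (hx ▸ hxi), e]
    | some a =>
      have h1 := (h.2 i).1 a hxi
      rw [e] at h1
      exact h1.unique ((h'.2 i).1 a (hx ▸ hxi))

theorem IsRun.eq_of_not_actsAt {x : Stream'.Seq Act} {σ : ℕ → C.Global} (h : C.IsRun x σ) {p : P}
    {m n : ℕ} (hmn : m ≤ n) (hx : ∀ i, m ≤ i → i < n → ¬ D.ActsAt x p i) : σ n p = σ m p := by
  induction hmn with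
  | refl => rfl
  | @step n hn ih =>
    rw [← ih fun i h1 h2 => hx i h1 (h2.trans (Nat.lt_succ_self n))]
    cases hxn : x.get? n with
    | none => rw [(h.2 n).2 hxn]
    | some a =>
      exact ((h.2 n).1 a hxn).2 p fun hp => hx n hn (Nat.lt_succ_self n) ⟨a, hxn, hp⟩

theorem get?_ofList_append_of_lt {y : List Act} {z : Stream'.Seq Act} {n : ℕ}
    (h : n < y.length) : ((Stream'.Seq.ofList y).append z).get? n = y[n]? := by
  induction y generalizing n with
  | nil => simp at h
  | cons b y ih =>
    rw [Stream'.Seq.ofList_cons, Stream'.Seq.cons_append]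
    cases n with
    | zero => simp
    | succ n => simpa using ih (by simpa using h)

theorem get?_ofList_append_add {y : List Act} {z : Stream'.Seq Act} {n : ℕ} :
    ((Stream'.Seq.ofList y).append z).get? (y.length + n) = z.get? n := by
  induction y with
  | nil => simp
  | cons b y ih =>
    rw [Stream'.Seq.ofList_cons, Stream'.Seq.cons_append, List.length_cons, Nat.add_right_comm,
      Stream'.Seq.get?_cons_succ, ih]

/-- A run is maximal iff no action is enabled in the final states of the processes of its
location. -/
theorem IsRun.isMaximal_iff {x : Stream'.Seq Act} {σ : ℕ → C.Global} (h : C.IsRun x σ) :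
    C.IsMaximal x ↔ ∀ n a, (∀ m, n ≤ m → ∀ p ∈ D.dom a, ¬ D.ActsAt x p m) →
      ∀ s, ¬ C.Step (σ n) a s := by
  classical
  constructor
  · intro hmax n a hn s hs
    -- Beyond the end of a finite word the state does not change, so that `n` can be lowered.
    obtain ⟨y, hy, hσ⟩ : ∃ y : List Act, (∀ i, y.length ≤ i → ∀ p ∈ D.dom a, ¬ D.ActsAt x p i) ∧
        σ y.length = σ n ∧ ∀ i < y.length, x.get? i = y[i]? := by
      induction n with
      | zero => exact ⟨[], fun i _ => hn i (Nat.zero_le _), rfl, by simp⟩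
      | succ n ih =>
        cases hx : x.get? n with
        | none =>
          have e := (h.2 n).2 hx
          rw [e] at hs ⊢
          refine ih (fun m hm p hp => ?_) hs
          rcases hm.eq_or_lt with rfl | hm
          · rintro ⟨b, hb, -⟩
            simp [hx] at hb
          · exact hn m hm p hp
        | some b =>
          have hall : ∀ i < n + 1, (x.get? i).isSome := fun i hi => by
            obtain ⟨c, hc⟩ := x.ge_stable (Nat.le_of_lt_succ hi) hx
            simp [hc]
          let y := List.ofFn fun i : Fin (n + 1) => (x.get? i).get (hall i i.2)
          have hlen : y.length = n + 1 := List.length_ofFn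
          refine ⟨y, by rwa [hlen], by rw [hlen], fun i hi => ?_⟩
          rw [hlen] at hi
          rw [List.getElem?_eq_getElem (by omega), List.getElem_ofFn]
          simp
    obtain ⟨hσ, hyx⟩ := hσ
    refine hmax ⟨y, x.drop y.length, a, ?_, ?_, ?_⟩
    · refine Stream'.Seq.ext fun i => ?_
      rcases Nat.lt_or_ge i y.length with hi | hi
      · rw [get?_ofList_append_of_lt hi, hyx i hi]
      · obtain ⟨j, rfl⟩ := Nat.exists_eq_add_of_le hi
        rw [get?_ofList_append_add, Stream'.Seq.drop_get?]
    · rw [Set.eq_empty_iff_forall_notMem]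
      rintro p ⟨⟨b, hb, hpb⟩, hpa⟩
      obtain ⟨i, hi⟩ := Stream'.Seq.mem_iff_exists_get?.1 hb
      rw [Stream'.Seq.drop_get?] at hi
      exact hy _ (Nat.le_add_right _ i) p hpa ⟨b, hi.symm, hpb⟩
    · refine ⟨fun i => if i ≤ y.length then σ i else
        fun p => if p ∈ D.dom a then s p else σ (i - 1) p, ?_, fun i => ?_⟩
      · simpa using h.1
      · rcases Nat.lt_or_ge i y.length with hi | hi
        · have hi' : i + 1 ≤ y.length := hi
          simp only [get?_ofList_append_of_lt hi, ← hyx i hi, hi.le, hi', if_true]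
          exact h.2 i
        · obtain ⟨j, rfl⟩ := Nat.exists_eq_add_of_le hi
          rw [get?_ofList_append_add]
          have h1 : ¬ y.length + j + 1 ≤ y.length := by omega
          simp only [h1, if_false, Nat.add_sub_cancel]
          cases j with
          | zero =>
            simp only [Stream'.Seq.get?_cons_zero, Option.some.injEq, forall_eq',
              reduceCtorEq, false_imp_iff, and_true, Nat.add_zero, le_refl, if_true]
            obtain ⟨t, ht, ht1, ht2⟩ := hs.exists_of_eqOn (t := σ y.length)
              (fun p _ => by rw [hσ])
            convert ht using 1
            funext p
            by_cases hp : p ∈ D.dom a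
            · simp [hp, ht1]
            · simp [hp, ht2]
          | succ j =>
            have h2 : ¬ y.length + (j + 1) ≤ y.length := by omega
            have h3 : y.length + (j + 1) - 1 = y.length + j := by omega
            simp only [Stream'.Seq.get?_cons_succ, h2, if_false, h3, Stream'.Seq.drop_get?]
            rw [← Nat.add_assoc]
            have h4 := h.2 (y.length + j)
            refine ⟨fun b hb => ?_, fun hb => ?_⟩
            · have hdis : ∀ p ∈ D.dom b, p ∉ D.dom a := fun p hp hpa =>
                hy _ (Nat.le_add_right _ j) p hpa ⟨b, hb, hp⟩
              obtain ⟨t, ht, ht1, ht2⟩ := (h4.1 b hb).exists_of_eqOn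
                (t := fun p => if p ∈ D.dom a then s p else σ (y.length + j) p)
                (fun p hp => by simp [hdis p hp])
              convert ht using 1
              funext p
              by_cases hp : p ∈ D.dom b
              · simpa [hdis p hp] using (ht1 p hp).symm
              · rw [ht2 p hp]
                by_cases hpa : p ∈ D.dom a
                · simp [hpa]
                · simpa [hpa] using (h4.1 b hb).2 p hp
            · rw [h4.2 hb]
  · rintro hmax ⟨y, z, a, rfl, hz, σ', hσ'⟩
    have e : σ y.length = σ' y.length := h.unique_upto hσ' (fun i hi => by
      rw [get?_ofList_append_of_lt hi, get?_ofList_append_of_lt hi]) _ le_rfl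
    have hstep := (hσ'.2 y.length).1 a (by
      have := get?_ofList_append_add (y := y) (z := Stream'.Seq.cons a z) (n := 0)
      simpa using this)
    rw [← e] at hstep
    refine hmax y.length a (fun m hm p hp => ?_) _ hstep
    rintro ⟨b, hb, hpb⟩
    obtain ⟨j, rfl⟩ := Nat.exists_eq_add_of_le hm
    rw [get?_ofList_append_add] at hb
    have : p ∈ D.wordDom z ∩ D.dom a := ⟨⟨b, Stream'.Seq.get?_mem hb, hpb⟩, hp⟩
    rw [hz] at this
    exact this

/-- `C.Steps s l s'`: the sequence `l` of actions leads from `s` to `s'`. -/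
def Steps (C : ZielonkaAutomaton.{u} D) : C.Global → List Act → C.Global → Prop
  | s, [], s' => s' = s
  | s, a :: l, s' => ∃ t, C.Step s a t ∧ Steps C t l s'

theorem Steps.append {s t s' : C.Global} {l l' : List Act} (h : C.Steps s l t)
    (h' : C.Steps t l' s') : C.Steps s (l ++ l') s' := by
  induction l generalizing s with
  | nil => obtain rfl : t = s := h; exact h'
  | cons a l ih =>
    obtain ⟨t', h1, h2⟩ := h
    exact ⟨t', h1, ih h2⟩

theorem Steps.isRun_prefix {x : Stream'.Seq Act} {σ : ℕ → C.Global} {n : ℕ} {l : List Act}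
    {s : C.Global} (h : C.Steps (σ n) l s) (hx : ∀ i < l.length, x.get? (n + i) = l[i]?)
    (hσ : ∀ i a t, x.get? i = some a → C.Step (σ i) a t → σ (i + 1) = t) :
    σ (n + l.length) = s ∧ ∀ i < l.length, ∀ a, x.get? (n + i) = some a →
      C.Step (σ (n + i)) a (σ (n + i + 1)) := by
  induction l generalizing n with
  | nil => exact ⟨(show s = σ n from h).symm, by simp⟩
  | cons a l ih =>
    obtain ⟨t, h1, h2⟩ := h
    have hx0 : x.get? n = some a := by simpa using hx 0 (by simp)
    have ht := hσ n a t hx0 h1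
    rw [← ht] at h1 h2
    obtain ⟨h3, h4⟩ := ih h2 fun i hi => by
      have := hx (i + 1) (by simpa using hi)
      rw [show n + 1 + i = n + (i + 1) by omega, this]
      simp
    refine ⟨by rw [← h3, List.length_cons]; congr 1; omega, fun i hi b hb => ?_⟩
    cases i with
    | zero =>
      obtain rfl : a = b := by simpa [hx0] using hb
      exact h1
    | succ i =>
      have := h4 i (by simpa using hi) b (by rwa [show n + 1 + i = n + (i + 1) by omega])
      rwa [show n + 1 + i = n + (i + 1) by omega] at this

/-- A sequence of finite words `w n` that lead from `ρ n` to `ρ (n + 1)` can be concatenated to a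
run. The word `W n` is the concatenation of `w 0, …, w (n - 1)`. -/
theorem exists_run_of_blocks {ρ : ℕ → C.Global} {w : ℕ → List Act} (h0 : ρ 0 = C.init)
    (hw : ∀ n, C.Steps (ρ n) (w n) (ρ (n + 1))) :
    ∃ (x : Stream'.Seq Act) (σ : ℕ → C.Global) (W : ℕ → List Act), C.IsRun x σ ∧ W 0 = [] ∧
      (∀ n, W (n + 1) = W n ++ w n) ∧ (∀ n, σ (W n).length = ρ n) ∧
      (∀ n i, i < (W n).length → x.get? i = (W n)[i]?) ∧
      ∀ i, (∀ n, (W n).length ≤ i) → x.get? i = none := by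
  classical
  let W : ℕ → List Act := fun n => Nat.rec [] (fun n l => l ++ w n) n
  have hW : ∀ n, W (n + 1) = W n ++ w n := fun n => rfl
  have hpre : ∀ m n, m ≤ n → W m <+: W n := by
    intro m n hmn
    induction hmn with
    | refl => exact List.prefix_rfl
    | step _ ih => exact ih.trans (List.prefix_append _ _)
  have hget : ∀ i m n, i < (W m).length → i < (W n).length → (W m)[i]? = (W n)[i]? := by
    intro i m n hm hn
    rcases le_total m n with h | h
    · obtain ⟨l, hl⟩ := hpre m n h
      rw [← hl, List.getElem?_append_left hm]
    · obtain ⟨l, hl⟩ := hpre n m h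
      rw [← hl, List.getElem?_append_left hn]
  let g : ℕ → Option Act := fun i =>
    if h : ∃ n, i < (W n).length then (W h.choose)[i]? else none
  have hg : ∀ n i, i < (W n).length → g i = (W n)[i]? := by
    intro n i hi
    have h : ∃ n, i < (W n).length := ⟨n, hi⟩
    simp only [g, dif_pos h]
    exact hget _ _ _ h.choose_spec hi
  have hg' : ∀ i, (∀ n, (W n).length ≤ i) → g i = none := by
    intro i hi
    simp only [g]
    rw [dif_neg]
    simpa using hi
  have hseq : Stream'.IsSeq g := by
    intro i hi
    refine hg' _ fun n => ?_
    by_contra! hn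
    have h1 : g i = (W n)[i]? := hg n i (by omega)
    rw [show g i = none from hi, eq_comm, List.getElem?_eq_none_iff] at h1
    omega
  let x : Stream'.Seq Act := ⟨g, hseq⟩
  have hxg : ∀ i, x.get? i = g i := fun i => rfl
  -- The run is generated by the deterministic transitions; where a letter is not enabled, the value
  -- of `nxt` is irrelevant.
  let nxt : C.Global → Option Act → C.Global := fun s o =>
    if h : ∃ t a, o = some a ∧ C.Step s a t then h.choose else s
  have hnxt : ∀ s a t, C.Step s a t → nxt s (some a) = t := by
    intro s a t h
    have h' : ∃ t b, some a = some b ∧ C.Step s b t := ⟨t, a, rfl, h⟩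
    obtain ⟨b, hb, h2⟩ := h'.choose_spec
    simp only [nxt, dif_pos h']
    rw [← Option.some.inj hb] at h2
    exact h2.unique h
  have hnxt' : ∀ s, nxt s none = s := fun s => by simp [nxt]
  let σ : ℕ → C.Global := fun n => Nat.rec C.init (fun n s => nxt s (g n)) n
  have hσs : ∀ n, σ (n + 1) = nxt (σ n) (g n) := fun n => rfl
  have hσ : ∀ i a t, x.get? i = some a → C.Step (σ i) a t → σ (i + 1) = t := by
    intro i a t hi ht
    rw [hσs, ← hxg, hi, hnxt _ _ _ ht]
  have hsteps : ∀ n, C.Steps (σ 0) (W n) (ρ n) := by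
    intro n
    induction n with
    | zero => exact h0
    | succ n ih => exact ih.append (hw n)
  have hrun := fun n => (hsteps n).isRun_prefix (x := x) (n := 0)
    (fun i hi => by rw [Nat.zero_add]; exact hg n i hi) hσ
  refine ⟨x, σ, W, ⟨rfl, fun i => ⟨fun a ha => ?_, fun hn => ?_⟩⟩, rfl, hW,
    fun n => by simpa using (hrun n).1, hg, hg'⟩
  · by_cases h : ∃ n, i < (W n).length
    · obtain ⟨n, hn⟩ := h
      simpa using (hrun n).2 i hn a (by simpa using ha)
    · push Not at h
      rw [hxg, hg' i h] at ha
      exact absurd ha (by simp)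
  · rw [hσs, ← hxg, hn, hnxt']

/-- A process with infinitely many actions has a projection, in which its states appear in the
order of time. -/
theorem exists_isProjection {x : Stream'.Seq Act} {σ : ℕ → C.Global} {p : P}
    (hinf : ∃ᶠ n in atTop, D.ActsAt x p n) : ∃ t, C.IsProjection x σ p t := by
  classical
  have hinf' : {n | D.ActsAt x p n}.Infinite := Nat.frequently_atTop_iff_infinite.1 hinf
  have hr := Nat.range_nth_of_infinite (p := D.ActsAt x p) hinf'
  choose a ha using fun k => (show D.ActsAt x p (Nat.nth (D.ActsAt x p) k) from
    Nat.nth_mem_of_infinite hinf' k)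
  exact ⟨fun k => (σ (Nat.nth (D.ActsAt x p) k) p, a k, σ (Nat.nth (D.ActsAt x p) k + 1) p),
    Nat.nth (D.ActsAt x p), Nat.nth_strictMono hinf', hr, fun k => ⟨rfl, (ha k).1, rfl⟩⟩

theorem map_count_atTop {Q : ℕ → Prop} [DecidablePred Q] (hQ : {n | Q n}.Infinite) :
    map (Nat.count Q) atTop = atTop :=
  map_atTop_eq_of_gc (Nat.nth Q) 0 (Nat.count_monotone _)
    (fun _ _ _ => Nat.count_le_iff_le_nth hQ) (fun b _ => by rw [Nat.count_nth_of_infinite hQ])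

theorem IsRun.evenLimsup_projection_iff {x : Stream'.Seq Act} {σ : ℕ → C.Global}
    (h : C.IsRun x σ) {p : P} {e : ℕ → ℕ} (he : StrictMono e)
    (hr : Set.range e = {n | D.ActsAt x p n}) (rk : C.State p → ℕ) :
    EvenLimsup (fun k => rk (σ (e k) p)) ↔ EvenLimsup fun n => rk (σ n p) := by
  classical
  have hinf : {n | D.ActsAt x p n}.Infinite := hr ▸ Set.infinite_range_of_injective he.injective
  have hen : e = Nat.nth (D.ActsAt x p) :=
    (StrictMono.range_inj he (Nat.nth_strictMono hinf)).1
      (hr.trans (Nat.range_nth_of_infinite hinf).symm)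
  rw [← EvenLimsup.comp_iff (map_count_atTop hinf)]
  have : ∀ n, σ (e (Nat.count (D.ActsAt x p) n)) p = σ n p := by
    intro n
    rw [hen]
    refine h.eq_of_not_actsAt ((Nat.count_le_iff_le_nth hinf).1 le_rfl) fun i h1 h2 h3 => ?_
    have h4 : Nat.count (D.ActsAt x p) i < Nat.count (D.ActsAt x p) n := by
      rwa [← (Nat.nth_strictMono hinf).lt_iff_lt, Nat.nth_count h3]
    exact absurd (Nat.count_monotone (D.ActsAt x p) h1) (by omega)
  simp only [this]

end Runs

end ZielonkaAutomaton

/-! ### The controller that moves through representatives -/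

namespace ZielonkaAutomaton

variable {P : Type v} {Act : Type w} {D : DistAlphabet P Act}

section LastTime

/-- The time just after the last `j < n` with `Q j`, or `0` if there is no such `j`. -/
theorem exists_last_time (Q : ℕ → Prop) (n : ℕ) :
    ∃ l ≤ n, (l = 0 ∨ ∃ j, l = j + 1 ∧ Q j) ∧ ∀ j, l ≤ j → j < n → ¬ Q j := by
  induction n with
  | zero => exact ⟨0, le_rfl, .inl rfl, by omega⟩
  | succ n ih =>
    by_cases h : Q n
    · exact ⟨n + 1, le_rfl, .inr ⟨n, rfl, h⟩, by omega⟩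
    · obtain ⟨l, hl, h1, h2⟩ := ih
      refine ⟨l, by omega, h1, fun j hj hjn => ?_⟩
      rcases (Nat.le_of_lt_succ hjn).eq_or_lt with rfl | hjn
      · exact h
      · exact h2 j hj hjn

/-- If there are infinitely many communications, then the ranks of an `r`-aware automaton are
eventually bounded by `m` iff this holds for the maxima of the segments between consecutive
communications, which are read off the states in which the communications take place. -/
theorem eventually_rank_le_iff {A : ZielonkaAutomaton.{u} D} {r q : P} {rank f : A.State r → ℕ}
    {x : Stream'.Seq Act} {σ : ℕ → A.Global}
    (hf : ∀ l n, l ≤ n → (l = 0 ∨ ∃ j, l = j + 1 ∧ D.CommAt x r q j) →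
      (∀ j, l ≤ j → j < n → ¬ D.CommAt x r q j) →
      IsGreatest {k | ∃ m, l ≤ m ∧ m ≤ n ∧ rank (σ m r) = k} (f (σ n r)))
    (hinf : ∃ᶠ n in atTop, D.CommAt x r q n) (m : ℕ) :
    (∀ᶠ n in atTop, rank (σ n r) ≤ m) ↔
      ∀ᶠ n in atTop, D.CommAt x r q n → f (σ n r) ≤ m := by
  classical
  constructor
  · intro h
    obtain ⟨N, hN⟩ := eventually_atTop.1 h
    obtain ⟨j, hj, hcj⟩ := frequently_atTop.1 hinf N
    refine eventually_atTop.2 ⟨j + 1, fun n hn _ => ?_⟩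
    obtain ⟨l, hl, h1, h2⟩ := exists_last_time (D.CommAt x r q) n
    obtain ⟨i, hi, _, hi'⟩ := (hf l n hl h1 h2).1
    have : j < l := by
      by_contra! hlj
      exact h2 j hlj hn hcj
    rw [← hi']
    exact hN i (by omega)
  · intro h
    obtain ⟨N, hN⟩ := eventually_atTop.1 h
    refine eventually_atTop.2 ⟨N, fun k hk => ?_⟩
    have hex : ∃ n, k ≤ n ∧ D.CommAt x r q n := frequently_atTop.1 hinf k
    obtain ⟨hn, hc⟩ := Nat.find_spec hex
    obtain ⟨l, hl, h1, h2⟩ := exists_last_time (D.CommAt x r q) k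
    refine le_trans ((hf l _ (hl.trans hn) h1 ?_).2 ⟨k, hl, hn, rfl⟩) (hN _ (hk.trans hn) hc)
    intro j hj hjn hcj
    rcases Nat.lt_or_ge j k with h | h
    · exact h2 j hj h hcj
    · exact Nat.find_min hex hjn ⟨h, hcj⟩

end LastTime

theorem dom_eq_singleton_of_isLeafOf {r q : P} (h : D.IsLeafOf r q) {a : Act} (hr : r ∈ D.dom a)
    (hq : q ∉ D.dom a) : D.dom a = {r} := by
  refine Set.eq_singleton_iff_unique_mem.2 ⟨hr, fun p hp => ?_⟩
  by_contra hne
  have : p = q := h.2 ⟨Ne.symm hne, a, hr, hp⟩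
  exact hq (this ▸ hp)

section LocalPaths

variable {C : ZielonkaAutomaton.{u} D}

theorem Step.localStep {r : P} {s t : C.Global} {a : Act} (h : C.Step s a t)
    (ha : D.dom a = {r}) : C.LocalStep r (s r) (t r) :=
  ⟨a, by simp [ha], ha, _, _, h.1, rfl, rfl⟩

theorem LocalStep.exists_step [DecidableEq P] {r : P} {c c' : C.State r}
    (h : C.LocalStep r c c') : ∃ a, D.dom a = {r} ∧
      ∀ s : C.Global, C.Step (Function.update s r c) a (Function.update s r c') := by
  obtain ⟨a, hr, ha, t, t', hδ, rfl, rfl⟩ := h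
  have key : ∀ (s : C.Global) (t : ∀ p : D.dom a, C.State p),
      (fun p : D.dom a => Function.update s r (t ⟨r, hr⟩) p) = t := by
    intro s t
    funext p
    obtain ⟨p, hp⟩ := p
    obtain rfl : p = r := by simpa [ha] using hp
    simp
  refine ⟨a, ha, fun s => ⟨?_, fun p hp => ?_⟩⟩
  · rw [key, key, hδ]
  · have : p ≠ r := fun h => hp (h ▸ hr)
    simp [this]

/-- The word `l` of local `r`-actions leads from the `r`-state `c` to `c'`. -/
def LocalPath [DecidableEq P] (C : ZielonkaAutomaton.{u} D) (r : P) (c : C.State r)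
    (l : List Act) (c' : C.State r) : Prop :=
  (∀ a ∈ l, D.dom a = {r}) ∧
    ∀ s : C.Global, C.Steps (Function.update s r c) l (Function.update s r c')

theorem LocalPath.nil [DecidableEq P] {r : P} (c : C.State r) : C.LocalPath r c [] c :=
  ⟨by simp, fun _ => rfl⟩

theorem LocalStep.exists_localPath [DecidableEq P] {r : P} {c c' : C.State r}
    (h : C.LocalStep r c c') : ∃ a, C.LocalPath r c [a] c' := by
  obtain ⟨a, ha, hs⟩ := h.exists_step
  exact ⟨a, by simpa using ha, fun s => ⟨_, hs s, rfl⟩⟩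

theorem exists_localPath [DecidableEq P] {r : P} {c c' : C.State r}
    (h : ReflTransGen (C.LocalStep r) c c') : ∃ l, C.LocalPath r c l c' := by
  induction h with
  | refl => exact ⟨[], .nil c⟩
  | tail _ h ih =>
    obtain ⟨l, hl, hs⟩ := ih
    obtain ⟨a, ha, hs'⟩ := h.exists_localPath
    refine ⟨l ++ [a], fun b hb => ?_, fun s => (hs s).append (hs' s)⟩
    rcases List.mem_append.1 hb with hb | hb
    · exact hl b hb
    · exact ha b hb

end LocalPaths

section Collapse

/-- The automaton in which each process `p` remembers, besides its state in `C`, the state `b`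
that it had after its last non-local action (its initial state if there was none), and in which it
always moves on to the representative `rep p b c` of its new state `c`. Pairs whose second component
is not a representative are excluded, as otherwise unreachable states could violate
`RMemoryless`. -/
noncomputable def collapse (C : ZielonkaAutomaton.{u} D)
    (rep : ∀ p, C.State p → C.State p → C.State p)
    (hrep : ∀ p b c, rep p b (rep p b c) = rep p b c) : ZielonkaAutomaton.{u} D where
  State p := {s : C.State p × C.State p // rep p s.1 s.2 = s.2}
  finite_state p :=
    have := C.finite_state p
    inferInstance
  init p := ⟨(C.init p, rep p (C.init p) (C.init p)), hrep _ _ _⟩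
  δ a s := (C.δ a fun p => (s p).1.2).map fun t p =>
    open scoped Classical in
    let b := if D.dom a = {(p : P)} then (s p).1.1 else t p
    ⟨(b, rep p b (t p)), hrep _ _ _⟩

variable {C : ZielonkaAutomaton.{u} D} {rep : ∀ p, C.State p → C.State p → C.State p}
  {hrep : ∀ p b c, rep p b (rep p b c) = rep p b c}

/-- The state in `C` just after the last non-local action. -/
def collapse.base {p : P} (s : (C.collapse rep hrep).State p) : C.State p := s.1.1

/-- The current state in `C`. -/
def collapse.cur {p : P} (s : (C.collapse rep hrep).State p) : C.State p := s.1.2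

open collapse

theorem collapse.step_cur {s s' : (C.collapse rep hrep).Global} {a : Act}
    (h : (C.collapse rep hrep).Step s a s') : ∃ t : C.Global, C.Step (fun p => cur (s p)) a t ∧
      ∀ p ∈ D.dom a, cur (s' p) = rep p (base (s' p)) (t p) ∧
        (D.dom a = {p} → base (s' p) = base (s p)) ∧ (D.dom a ≠ {p} → base (s' p) = t p) := by
  obtain ⟨h1, h2⟩ := h
  obtain ⟨t, ht, hs'⟩ := Option.map_eq_some_iff.1 h1
  obtain ⟨T, hT⟩ := exists_step_of_isSome (C := C) (s := fun p => cur (s p)) (a := a)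
    (Option.isSome_iff_exists.2 ⟨t, ht⟩)
  refine ⟨T, hT, fun p hp => ?_⟩
  have e : T p = t ⟨p, hp⟩ := congrFun (Option.some.inj (hT.1.symm.trans ht)) ⟨p, hp⟩
  have e' := congrFun hs' ⟨p, hp⟩
  simp only at e'
  have hb := congrArg (fun s => s.1.1) e'
  have hc := congrArg (fun s => s.1.2) e'
  simp only at hb hc
  refine ⟨?_, fun ha => ?_, fun ha => ?_⟩
  · rw [e]
    change (s' p).1.2 = rep p (s' p).1.1 _
    rw [← hb, ← hc]
  · rw [if_pos ha] at hb
    exact hb.symm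
  · rw [if_neg ha, ← e] at hb
    exact hb.symm

theorem collapse.exists_step {s : (C.collapse rep hrep).Global} {a : Act} {t : C.Global}
    (h : C.Step (fun p => cur (s p)) a t) : ∃ s', (C.collapse rep hrep).Step s a s' := by
  refine exists_step_of_isSome (Option.isSome_map.trans ?_)
  exact Option.isSome_iff_exists.2 ⟨_, h.1⟩

/-- Along local `p`-actions the base state does not change. -/
theorem collapse.base_eq_of_localStep {p : P} {s s' : (C.collapse rep hrep).State p}
    (h : (C.collapse rep hrep).LocalStep p s s') : base s' = base s := by
  classical
  obtain ⟨a, ha, hs⟩ := h.exists_step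
  obtain ⟨t, -, ht⟩ := step_cur (hs (C.collapse rep hrep).init)
  simpa using (ht p (by simp [ha])).2.1 ha

theorem collapse.rMemoryless {A : ZielonkaAutomaton.{u} D} {π : ∀ p, C.State p → A.State p}
    {r : P} (h : ∀ b c c', π r c = π r c' → rep r b c = rep r b c') :
    A.RMemoryless (C.collapse rep hrep) (fun p s => π p (cur s)) r := by
  intro s s' hne hpath heq
  have hb : base s' = base s := by
    clear hne heq
    induction hpath with
    | refl => rfl
    | tail _ h ih => rw [base_eq_of_localStep h, ih]
  refine hne (Subtype.ext (Prod.ext hb.symm ?_))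
  have h1 := s.2
  have h2 := s'.2
  change rep r (base s) (cur s) = cur s at h1
  change rep r (base s') (cur s') = cur s' at h2
  change cur s = cur s'
  rw [← h1, ← h2, hb]
  exact h _ _ _ heq

theorem collapse.isCovering {A : ZielonkaAutomaton.{u} D} {π : ∀ p, C.State p → A.State p}
    (hC : A.IsCovering C π) (hπ : ∀ p b c, π p (rep p b c) = π p c) :
    A.IsCovering (C.collapse rep hrep) fun p s => π p (cur s) where
  init p := (hπ _ _ _).trans (hC.init p)
  step a c c' h := by
    obtain ⟨t, ht, rfl⟩ := Option.map_eq_some_iff.1 h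
    refine (hC.step a _ _ ht).trans ?_
    congr 1
    funext p
    exact (hπ _ _ _).symm
  env a ha c h :=
    Option.isSome_map.trans (hC.env a ha _ h)

end Collapse

theorem IsCovering.isRun {A C : ZielonkaAutomaton.{u} D} {π : ∀ p, C.State p → A.State p}
    (hC : A.IsCovering C π) {x : Stream'.Seq Act} {σ : ℕ → C.Global} (h : C.IsRun x σ) :
    A.IsRun x fun n p => π p (σ n p) := by
  refine ⟨funext fun p => (congrArg (π p) (congrFun h.1 p)).trans (hC.init p), fun n => ⟨fun a ha => ?_, fun hn => ?_⟩⟩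
  · have hs := (h.2 n).1 a ha
    exact ⟨hC.step a _ _ hs.1, fun p hp => congrArg (π p) (hs.2 p hp)⟩
  · simp only [(h.2 n).2 hn]

theorem IsCorrectController.isCorrectCovering {A C : ZielonkaAutomaton.{u} D} {K : A.Corr}
    (h : A.IsCorrectController K C) :
    A.IsCorrectCovering K (A.prod C) fun _ s => s.1 := by
  refine ⟨⟨fun _ => rfl, fun a c c' hc => ?_, fun a ha c hc => ?_⟩, h.2⟩
  · obtain ⟨t, ht, hc⟩ := Option.bind_eq_some_iff.1 hc
    obtain ⟨t', -, rfl⟩ := Option.map_eq_some_iff.1 hc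
    exact ht
  · obtain ⟨t, ht⟩ := Option.isSome_iff_exists.1 hc
    obtain ⟨t', ht'⟩ := Option.isSome_iff_exists.1 (h.1 a ha fun p => (c p).2)
    exact Option.isSome_iff_exists.2 ⟨_, Option.bind_eq_some_iff.2
      ⟨t, ht, Option.map_eq_some_iff.2 ⟨t', ht', rfl⟩⟩⟩

end ZielonkaAutomaton

/-! ### Simulation by runs of the original controller -/

namespace ZielonkaAutomaton

variable {P : Type v} {Act : Type w} {D : DistAlphabet P Act}

section Simulation

open collapse

/-- The run with label `x'` and states `σ'` is obtained from the sequence `s` of states that belongs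
to the label `x` by replacing the `n`-th letter by the word `v n` of local `r`-actions, followed by
the letter itself unless that is a local `r`-action. The block for the `n`-th letter starts at
position `L n`, and there the state of `r` is `β n`, while the other processes have the same state
as in `s n`. In communications of `r` with `q` the states agree completely. -/
structure Simulation [DecidableEq P] (C : ZielonkaAutomaton.{u} D) (r q : P)
    (x : Stream'.Seq Act) (s : ℕ → C.Global) (β : ℕ → C.State r) (v : ℕ → List Act)
    (x' : Stream'.Seq Act) (σ' : ℕ → C.Global) (L : ℕ → ℕ) : Prop where
  run : C.IsRun x' σ'
  start_succ : ∀ n, (∃ a, x.get? n = some a ∧ D.dom a ≠ {r}) → L (n + 1) = L n + (v n).length + 1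
  start_succ_local : ∀ n, (¬ ∃ a, x.get? n = some a ∧ D.dom a ≠ {r}) →
    L (n + 1) = L n + (v n).length
  start_zero : L 0 = 0
  state : ∀ n, σ' (L n) = Function.update (s n) r (β n)
  state_comm : ∀ n, D.CommAt x r q n → σ' (L n + (v n).length) r = s n r
  dom_local : ∀ n, ∀ a ∈ v n, D.dom a = {r}
  get?_local : ∀ n i, i < (v n).length → x'.get? (L n + i) = (v n)[i]?
  get?_last : ∀ n a, x.get? n = some a → D.dom a ≠ {r} → x'.get? (L n + (v n).length) = some a
  get?_none : ∀ i, (∀ n, L n ≤ i) → x'.get? i = none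

variable {C : ZielonkaAutomaton.{u} D} {rep : ∀ p, C.State p → C.State p → C.State p}
  {hrep : ∀ p b c, rep p b (rep p b c) = rep p b c}

/-- A run of the collapsed automaton can be simulated in `C`, given local paths for `r` that lead
from the last communication to the state of `r` in the next one. -/
theorem exists_simulation [DecidableEq P] {r q : P} (hleaf : D.IsLeafOf r q)
    (hid : ∀ p, p ≠ r → ∀ b c, rep p b c = c) {x : Stream'.Seq Act}
    {σ : ℕ → (C.collapse rep hrep).Global} (hσ : (C.collapse rep hrep).IsRun x σ)
    {β : ℕ → C.State r} {v : ℕ → List Act} (h0 : β 0 = C.init r)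
    (hcomm : ∀ n, D.CommAt x r q n →
      β (n + 1) = base (σ (n + 1) r) ∧ C.LocalPath r (β n) (v n) (cur (σ n r)))
    (hlocal : ∀ n, ¬ D.CommAt x r q n → C.LocalPath r (β n) (v n) (β (n + 1))) :
    ∃ x' σ' L, C.Simulation r q x (fun n p => cur (σ n p)) β v x' σ' L := by
  classical
  let s : ℕ → C.Global := fun n p => cur (σ n p)
  let ρ : ℕ → C.Global := fun n => Function.update (s n) r (β n)
  -- The state of `r` at the end of the local path: a communication needs the actual state.
  let mid : ℕ → C.State r := fun n => if D.CommAt x r q n then s n r else β (n + 1)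
  let tl : ℕ → List Act := fun n =>
    if h : ∃ a, x.get? n = some a ∧ D.dom a ≠ {r} then [h.choose] else []
  have htl : ∀ n a, x.get? n = some a → D.dom a ≠ {r} → tl n = [a] := by
    intro n a ha hd
    have h : ∃ a, x.get? n = some a ∧ D.dom a ≠ {r} := ⟨a, ha, hd⟩
    simp only [tl, dif_pos h, Option.some.inj (ha.symm.trans h.choose_spec.1)]
  have htl' : ∀ n, (¬ ∃ a, x.get? n = some a ∧ D.dom a ≠ {r}) → tl n = [] := fun n h => by
    simp only [tl, dif_neg h]
  have hv : ∀ n, C.LocalPath r (β n) (v n) (mid n) := by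
    intro n
    by_cases h : D.CommAt x r q n
    · simpa only [mid, if_pos h] using (hcomm n h).2
    · simpa only [mid, if_neg h] using hlocal n h
  have hnocomm : ∀ n a, x.get? n = some a → (r ∉ D.dom a ∨ D.dom a = {r}) →
      ¬ D.CommAt x r q n := by
    rintro n a ha h ⟨b, hb, hr, hq⟩
    obtain rfl : a = b := Option.some.inj (ha.symm.trans hb)
    rcases h with h | h
    · exact h hr
    · exact hleaf.1 (by simpa [h, eq_comm] using hq)
  have hlast : ∀ n, C.Steps (Function.update (s n) r (mid n)) (tl n) (ρ (n + 1)) := by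
    intro n
    cases hx : x.get? n with
    | none =>
      rw [htl' n (by simp [hx])]
      have : ¬ D.CommAt x r q n := by
        rintro ⟨a, ha, -⟩
        simp [hx] at ha
      change Function.update (s (n + 1)) r (β (n + 1)) = Function.update (s n) r (mid n)
      simp only [mid, if_neg this, s, (hσ.2 n).2 hx]
    | some a =>
      obtain ⟨t, ht, htp⟩ := step_cur ((hσ.2 n).1 a hx)
      have hkeep : ∀ p, p ∉ D.dom a → s (n + 1) p = s n p := fun p hp =>
        congrArg cur (((hσ.2 n).1 a hx).2 p hp)
      have hmove : ∀ p, p ≠ r → s (n + 1) p = t p := by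
        intro p hpr
        by_cases hp : p ∈ D.dom a
        · exact (htp p hp).1.trans (hid p hpr _ _)
        · exact (hkeep p hp).trans (ht.2 p hp).symm
      by_cases hd : D.dom a = {r}
      · rw [htl' n (by simp [hx, hd])]
        change Function.update (s (n + 1)) r (β (n + 1)) = Function.update (s n) r (mid n)
        simp only [mid, if_neg (hnocomm n a hx (.inr hd))]
        funext p
        by_cases hp : p = r
        · subst hp
          simp
        · simp only [Function.update_of_ne hp]
          exact hkeep p (by simpa [hd] using hp)
      · rw [htl n a hx hd]
        by_cases hr : r ∈ D.dom a
        · have hc : D.CommAt x r q n := ⟨a, hx, hr, by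
            by_contra hq
            exact hd (dom_eq_singleton_of_isLeafOf hleaf hr hq)⟩
          have e1 : Function.update (s n) r (mid n) = s n := by simp [mid, if_pos hc]
          refine ⟨t, by rwa [e1], ?_⟩
          change Function.update (s (n + 1)) r (β (n + 1)) = t
          funext p
          by_cases hp : p = r
          · subst hp
            rw [Function.update_self, (hcomm n hc).1, (htp p hr).2.2 hd]
          · rw [Function.update_of_ne hp, hmove p hp]
        · have hc := hnocomm n a hx (.inl hr)
          obtain ⟨t', ht', h1, h2⟩ := ht.exists_of_eqOn (t := Function.update (s n) r (mid n))
            (fun p hp => by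
              have : p ≠ r := fun h => hr (h ▸ hp)
              rw [Function.update_of_ne this])
          refine ⟨t', ht', ?_⟩
          change Function.update (s (n + 1)) r (β (n + 1)) = t'
          funext p
          by_cases hp : p = r
          · subst hp
            rw [h2 p hr, Function.update_self, Function.update_self]
            simp only [mid, if_neg hc]
          · rw [Function.update_of_ne hp, hmove p hp]
            by_cases hpa : p ∈ D.dom a
            · exact (h1 p hpa).symm
            · rw [h2 p hpa, Function.update_of_ne hp]
              exact ht.2 p hpa
  have hρ0 : ρ 0 = C.init := by
    funext p
    by_cases hp : p = r
    · subst hp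
      simp [ρ, h0]
    · simp only [ρ, Function.update_of_ne hp, s, hσ.1]
      exact hid p hp _ _
  obtain ⟨x', σ', W, hrun, hW0, hW, hst, hget, hnone⟩ := exists_run_of_blocks hρ0
    (w := fun n => v n ++ tl n) fun n => ((hv n).2 (s n)).append (hlast n)
  have hget' : ∀ n i, i < (v n ++ tl n).length → x'.get? ((W n).length + i) = (v n ++ tl n)[i]? := by
    intro n i hi
    rw [hget (n + 1) _ (by rw [hW, List.length_append]; omega), hW,
      List.getElem?_append_right (by omega)]
    congr 1
    omega
  have hgetv : ∀ n i, i < (v n).length → x'.get? ((W n).length + i) = (v n)[i]? := by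
    intro n i hi
    rw [hget' n i (by rw [List.length_append]; omega), List.getElem?_append_left hi]
  refine ⟨x', σ', fun n => (W n).length, hrun, fun n h => ?_, fun n h => ?_, by simp [hW0], hst,
    fun n h => ?_, fun n => (hv n).1, hgetv, fun n a ha hd => ?_, hnone⟩
  · obtain ⟨a, ha, hd⟩ := h
    rw [hW, htl n a ha hd, List.length_append, List.length_append, List.length_singleton,
      Nat.add_assoc]
  · rw [hW, htl' n h, List.append_nil, List.length_append]
  · have hs := (hv n).2 (s n)
    rw [show Function.update (s n) r (β n) = σ' (W n).length from (hst n).symm] at hs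
    have := (hs.isRun_prefix (hgetv n) fun i a t hi ht => ((hrun.2 i).1 a hi).unique ht).1
    rw [this]
    simp [mid, if_pos h, s]
  · rw [hget' n _ (by simp [htl n a ha hd]), htl n a ha hd]
    simp

namespace Simulation

variable [DecidableEq P] {r q : P} {x x' : Stream'.Seq Act} {s σ' : ℕ → C.Global}
  {β : ℕ → C.State r} {v : ℕ → List Act} {L : ℕ → ℕ}

theorem le_succ (S : C.Simulation r q x s β v x' σ' L) (n : ℕ) :
    L n + (v n).length ≤ L (n + 1) := by
  by_cases h : ∃ a, x.get? n = some a ∧ D.dom a ≠ {r}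
  · rw [S.start_succ n h]
    omega
  · rw [S.start_succ_local n h]

theorem mono (S : C.Simulation r q x s β v x' σ' L) : Monotone L :=
  monotone_nat_of_le_succ fun n => le_trans (by omega) (S.le_succ n)

theorem exists_block (S : C.Simulation r q x s β v x' σ' L) {i n : ℕ} (h : i < L n) :
    ∃ m, L m ≤ i ∧ i < L (m + 1) := by
  induction n with
  | zero =>
    rw [S.start_zero] at h
    omega
  | succ n ih =>
    rcases Nat.lt_or_ge i (L n) with h' | h'
    · exact ih h'
    · exact ⟨n, h', h⟩

theorem exists_origin (S : C.Simulation r q x s β v x' σ' L) {i : ℕ} {a : Act}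
    (h : x'.get? i = some a) :
    (∃ n, i = L n + (v n).length ∧ x.get? n = some a ∧ D.dom a ≠ {r}) ∨
      D.dom a = {r} ∧ ∃ n, L n ≤ i ∧ i < L n + (v n).length := by
  obtain ⟨n, hn⟩ : ∃ n, i < L n := by
    by_contra! hn
    rw [S.get?_none i hn] at h
    simp at h
  obtain ⟨m, h1, h2⟩ := S.exists_block hn
  obtain ⟨j, rfl⟩ := Nat.exists_eq_add_of_le h1
  rcases Nat.lt_or_ge j (v m).length with hj | hj
  · rw [S.get?_local m j hj] at h
    exact .inr ⟨S.dom_local m a (List.mem_of_getElem? h), m, h1, by omega⟩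
  · by_cases hb : ∃ b, x.get? m = some b ∧ D.dom b ≠ {r}
    · rw [S.start_succ m hb] at h2
      obtain rfl : j = (v m).length := by omega
      obtain ⟨b, hb, hd⟩ := hb
      rw [S.get?_last m b hb hd] at h
      obtain rfl := Option.some.inj h
      exact .inl ⟨m, rfl, hb, hd⟩
    · rw [S.start_succ_local m hb] at h2
      omega

theorem actsAt_last (S : C.Simulation r q x s β v x' σ' L) {p : P} (hp : p ≠ r) {n : ℕ}
    (h : D.ActsAt x p n) : L (n + 1) = L n + (v n).length + 1 ∧
      ∃ a, x.get? n = some a ∧ x'.get? (L n + (v n).length) = some a ∧ p ∈ D.dom a := by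
  obtain ⟨a, ha, hpa⟩ := h
  have hd : D.dom a ≠ {r} := fun h => hp (by simpa [h] using hpa)
  exact ⟨S.start_succ n ⟨a, ha, hd⟩, a, ha, S.get?_last n a ha hd, hpa⟩

theorem exists_actsAt (S : C.Simulation r q x s β v x' σ' L) {p : P} (hp : p ≠ r) {i : ℕ}
    (h : D.ActsAt x' p i) : ∃ n, i = L n + (v n).length ∧ D.ActsAt x p n := by
  obtain ⟨a, ha, hpa⟩ := h
  rcases S.exists_origin ha with ⟨n, rfl, hn, -⟩ | ⟨hd, -⟩
  · exact ⟨n, rfl, a, hn, hpa⟩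
  · exact absurd (by simpa [hd] using hpa) hp

theorem state_mid (S : C.Simulation r q x s β v x' σ' L) {p : P} (hp : p ≠ r) (n : ℕ) :
    σ' (L n + (v n).length) p = s n p := by
  rw [S.run.eq_of_not_actsAt (Nat.le_add_right (L n) _), S.state, Function.update_of_ne hp]
  rintro i h1 h2 ⟨a, ha, hpa⟩
  obtain ⟨j, rfl⟩ := Nat.exists_eq_add_of_le h1
  rw [S.get?_local n j (by omega)] at ha
  rw [S.dom_local n a (List.mem_of_getElem? ha)] at hpa
  exact hp hpa

/-- The projections on the processes other than `r` are not changed. -/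
theorem isProjection {A : ZielonkaAutomaton.{u} D} (S : C.Simulation r q x s β v x' σ' L)
    {π : ∀ p, C.State p → A.State p} {p : P} (hp : p ≠ r) {t : ℕ → A.State p × Act × A.State p}
    (h : A.IsProjection x (fun n p => π p (s n p)) p t) :
    A.IsProjection x' (fun n p => π p (σ' n p)) p t := by
  obtain ⟨e, he, hr, ht⟩ := h
  have hact : ∀ k, D.ActsAt x p (e k) := fun k => by
    have : e k ∈ Set.range e := ⟨k, rfl⟩
    rwa [hr] at this
  refine ⟨fun k => L (e k) + (v (e k)).length, fun i j hij => ?_, ?_, fun k => ?_⟩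
  · have h1 := (S.actsAt_last hp (hact i)).1
    have h2 := S.mono (Nat.succ_le_of_lt (he hij))
    simp only [Nat.succ_eq_add_one] at h2 ⊢
    omega
  · ext i
    constructor
    · rintro ⟨k, rfl⟩
      obtain ⟨-, a, -, ha, hpa⟩ := S.actsAt_last hp (hact k)
      exact ⟨a, ha, hpa⟩
    · intro hi
      obtain ⟨n, rfl, hn⟩ := S.exists_actsAt hp hi
      have : n ∈ Set.range e := by rwa [hr]
      obtain ⟨k, rfl⟩ := this
      exact ⟨k, rfl⟩
  · obtain ⟨h1, h2, h3⟩ := ht k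
    obtain ⟨h4, a, h5, h6, -⟩ := S.actsAt_last hp (hact k)
    refine ⟨h1.trans (congrArg (π p) (S.state_mid hp _).symm), by rw [h6, ← h5, h2], ?_⟩
    rw [h3, ← h4]
    exact congrArg (π p) (by rw [S.state, Function.update_of_ne hp])

theorem not_actsAt (S : C.Simulation r q x s β v x' σ' L) {p : P} (hp : p ≠ r) {n : ℕ}
    (h : ∀ m, n ≤ m → ¬ D.ActsAt x p m) : ∀ i, L n ≤ i → ¬ D.ActsAt x' p i := by
  intro i hi hact
  obtain ⟨m, rfl, hm⟩ := S.exists_actsAt hp hact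
  refine h m ?_ hm
  by_contra! hlt
  have h1 := (S.actsAt_last hp hm).1
  have h2 := S.mono (Nat.succ_le_of_lt hlt)
  simp only [Nat.succ_eq_add_one] at h2
  omega

/-- The conditions on the processes other than `r` carry over. -/
theorem holds_of_ne {A : ZielonkaAutomaton.{u} D} (S : C.Simulation r q x s β v x' σ' L)
    {π : ∀ p, C.State p → A.State p} {K : A.Corr} (h : K.Holds x' fun n p => π p (σ' n p))
    {p : P} (hp : p ≠ r) :
    (∀ n, (∀ m, n ≤ m → ¬ D.ActsAt x p m) → π p (s n p) ∈ K.term p) ∧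
      ∀ t, A.IsProjection x (fun n p => π p (s n p)) p t → t ∈ K.inf p := by
  refine ⟨fun n hn => ?_, fun t ht => (h p).2 t (S.isProjection hp ht)⟩
  have := (h p).1 (L n) (S.not_actsAt hp hn)
  simp only [S.state, Function.update_of_ne hp] at this
  exact this

/-- The simulating run is maximal if `r` acts infinitely often in it, or if the final states of `r`
in both runs agree. -/
theorem isMaximal {σ : ℕ → (C.collapse rep hrep).Global}
    (S : C.Simulation r q x (fun n p => cur (σ n p)) β v x' σ' L)
    (hσ : (C.collapse rep hrep).IsRun x σ) (hmax : (C.collapse rep hrep).IsMaximal x)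
    (hr : (∃ᶠ i in atTop, D.ActsAt x' r i) ∨
      ∃ N, ∀ n, N ≤ n → β n = cur (σ n r) ∧ ¬ D.ActsAt x r n) : C.IsMaximal x' := by
  rw [S.run.isMaximal_iff]
  intro i a ha t ht
  obtain ⟨N, hN⟩ : ∃ N, r ∈ D.dom a → ∀ n, N ≤ n → β n = cur (σ n r) ∧ ¬ D.ActsAt x r n := by
    by_cases hra : r ∈ D.dom a
    · rcases hr with hr | ⟨N, hN⟩
      · obtain ⟨j, hj, hact⟩ := frequently_atTop.1 hr i
        exact absurd hact (ha j hj r hra)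
      · exact ⟨N, fun _ => hN⟩
    · exact ⟨0, fun h => absurd h hra⟩
  -- A position `L n` after which the processes of `a` do not move, and which is after `i` or after
  -- the end of the word.
  obtain ⟨n, hNn, hin, hafter⟩ : ∃ n, N ≤ n ∧ (∀ p ∈ D.dom a, σ' (L n) p = σ' i p) ∧
      ∀ j, L n ≤ j → ∀ p ∈ D.dom a, ¬ D.ActsAt x' p j := by
    by_cases h : ∃ n, i ≤ L n
    · obtain ⟨n, hn⟩ := h
      have hn' : i ≤ L (max n N) := hn.trans (S.mono (le_max_left _ _))
      exact ⟨max n N, le_max_right _ _,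
        fun p hp => S.run.eq_of_not_actsAt hn' fun j hj _ => ha j hj p hp,
        fun j hj => ha j (hn'.trans hj)⟩
    · push Not at h
      obtain ⟨n, hn⟩ : ∃ n, ∀ m, L m ≤ L n := by
        have hb : BddAbove (Set.range L) := ⟨i, by rintro _ ⟨m, rfl⟩; exact (h m).le⟩
        obtain ⟨n, hn⟩ := Nat.sSup_mem (Set.range_nonempty L) hb
        exact ⟨n, fun m => hn ▸ le_csSup hb ⟨m, rfl⟩⟩
      have hmax : ∀ m, L m ≤ L (max n N) := fun m =>
        (hn m).trans (S.mono (le_max_left _ _))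
      have hnone : ∀ j, L (max n N) ≤ j → ∀ p, ¬ D.ActsAt x' p j := by
        rintro j hj p ⟨b, hb, -⟩
        rw [S.get?_none j fun m => (hmax m).trans hj] at hb
        simp at hb
      exact ⟨max n N, le_max_right _ _,
        fun p _ => (S.run.eq_of_not_actsAt (h _).le fun j hj _ => hnone j hj p).symm,
        fun j hj p _ => hnone j hj p⟩
  obtain ⟨t', ht', -⟩ := ht.exists_of_eqOn (t := fun p => cur (σ n p)) (fun p hp => by
    rw [← hin p hp, S.state]
    by_cases hpr : p = r
    · subst hpr
      rw [Function.update_self, (hN hp n hNn).1]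
    · rw [Function.update_of_ne hpr])
  obtain ⟨s', hs'⟩ := collapse.exists_step ht'
  refine hσ.isMaximal_iff.1 hmax n a (fun m hm p hp hact => ?_) s' hs'
  by_cases hpr : p = r
  · subst hpr
    exact (hN hp m (hNn.trans hm)).2 hact
  · obtain ⟨-, b, -, hb, hpb⟩ := S.actsAt_last hpr hact
    exact hafter _ ((S.mono hm).trans (Nat.le_add_right _ _)) p hp ⟨b, hb, hpb⟩

end Simulation

end Simulation

end ZielonkaAutomaton

/-! ### Correctness of the controller -/

namespace ZielonkaAutomaton

variable {P : Type v} {Act : Type w} {D : DistAlphabet P Act}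

section Correctness

open collapse

variable {A C : ZielonkaAutomaton.{u} D} {r q : P}

/-- For a parity condition the projection on `r` may be replaced by the states of `r` at all
times. -/
theorem mem_inf_iff_evenLimsup {K : A.Corr} {rank : A.State r → ℕ} (hparity : K.IsParity r rank)
    {x : Stream'.Seq Act} {τ : ℕ → A.Global} (hτ : A.IsRun x τ)
    {t : ℕ → A.State r × Act × A.State r} (ht : A.IsProjection x τ r t) :
    t ∈ K.inf r ↔ EvenLimsup fun n => rank (τ n r) := by
  obtain ⟨e, he, hr, hte⟩ := ht
  rw [← hτ.evenLimsup_projection_iff he hr rank, hparity]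
  simp only [← (hte _).1]
  exact exists_congr fun m => and_congr_right fun _ => EvenLimsup.isLeast_iff.symm

theorem Corr.Holds.evenLimsup {K : A.Corr} {rank : A.State r → ℕ} {x : Stream'.Seq Act}
    {τ : ℕ → A.Global} (h : K.Holds x τ) (hparity : K.IsParity r rank) (hτ : A.IsRun x τ)
    (hinf : ∃ᶠ n in atTop, D.ActsAt x r n) : EvenLimsup fun n => rank (τ n r) := by
  obtain ⟨t, ht⟩ := exists_isProjection (σ := τ) hinf
  exact (mem_inf_iff_evenLimsup hparity hτ ht).1 ((h r).2 t ht)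

theorem Corr.holds_of_frequently {K : A.Corr} {rank : A.State r → ℕ} {x : Stream'.Seq Act}
    {τ : ℕ → A.Global} (hparity : K.IsParity r rank) (hτ : A.IsRun x τ)
    (hinf : ∃ᶠ n in atTop, D.ActsAt x r n) (hr : EvenLimsup fun n => rank (τ n r))
    (hne : ∀ p, p ≠ r → (∀ n, (∀ m, n ≤ m → ¬ D.ActsAt x p m) → τ n p ∈ K.term p) ∧
      ∀ t, A.IsProjection x τ p t → t ∈ K.inf p) : K.Holds x τ := by
  intro p
  by_cases hp : p = r
  · subst hp
    refine ⟨fun n hn => ?_, fun t ht => (mem_inf_iff_evenLimsup hparity hτ ht).2 hr⟩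
    obtain ⟨m, hm, hact⟩ := frequently_atTop.1 hinf n
    exact absurd hact (hn m hm)
  · exact hne p hp

theorem actsAt_of_commAt {x : Stream'.Seq Act} {n : ℕ} (h : D.CommAt x r q n) :
    D.ActsAt x r n := by
  obtain ⟨a, ha, hr, -⟩ := h
  exact ⟨a, ha, hr⟩

theorem dom_ne_of_commAt (hleaf : D.IsLeafOf r q) {a : Act} (hq : q ∈ D.dom a) :
    D.dom a ≠ {r} := fun h => hleaf.1 (by simpa [h, eq_comm] using hq)

theorem Simulation.commAt_iff [DecidableEq P] (hleaf : D.IsLeafOf r q) {x x' : Stream'.Seq Act}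
    {s σ' : ℕ → C.Global} {β : ℕ → C.State r} {v : ℕ → List Act} {L : ℕ → ℕ}
    (S : C.Simulation r q x s β v x' σ' L) {i : ℕ} :
    D.CommAt x' r q i ↔ ∃ n, i = L n + (v n).length ∧ D.CommAt x r q n := by
  constructor
  · rintro ⟨a, ha, hr, hq⟩
    rcases S.exists_origin ha with ⟨n, rfl, hn, -⟩ | ⟨hd, -⟩
    · exact ⟨n, rfl, a, hn, hr, hq⟩
    · exact absurd hd (dom_ne_of_commAt hleaf hq)
  · rintro ⟨n, rfl, a, ha, hr, hq⟩
    exact ⟨a, S.get?_last n a ha (dom_ne_of_commAt hleaf hq), hr, hq⟩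

theorem Simulation.start_succ_of_commAt [DecidableEq P] (hleaf : D.IsLeafOf r q)
    {x x' : Stream'.Seq Act} {s σ' : ℕ → C.Global} {β : ℕ → C.State r} {v : ℕ → List Act}
    {L : ℕ → ℕ} (S : C.Simulation r q x s β v x' σ' L) {n : ℕ} (h : D.CommAt x r q n) :
    L (n + 1) = L n + (v n).length + 1 := by
  obtain ⟨a, ha, -, hq⟩ := h
  exact S.start_succ n ⟨a, ha, dom_ne_of_commAt hleaf hq⟩

theorem exists_le_of_frequently_lt {L : ℕ → ℕ} (h : ∃ᶠ n in atTop, L n < L (n + 1))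
    (hL : Monotone L) (k : ℕ) : ∃ n, k ≤ L n := by
  induction k with
  | zero => exact ⟨0, Nat.zero_le _⟩
  | succ k ih =>
    obtain ⟨n, hn⟩ := ih
    obtain ⟨m, hm, hlt⟩ := frequently_atTop.1 h n
    exact ⟨m + 1, (hn.trans (hL hm)).trans_lt hlt⟩

variable {rep : ∀ p, C.State p → C.State p → C.State p}
  {hrep : ∀ p b c, rep p b (rep p b c) = rep p b c}
  {x : Stream'.Seq Act} {σ : ℕ → (C.collapse rep hrep).Global}

/-- A local `r`-action leads to the representative of its target in `C`, an action without `r` does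
not change the state of `r`, and after a communication the new state of `r` becomes its base. -/
theorem collapse.run_succ (hσ : (C.collapse rep hrep).IsRun x σ) (hleaf : D.IsLeafOf r q) (n : ℕ) :
    (D.CommAt x r q n →
      cur (σ (n + 1) r) = rep r (base (σ (n + 1) r)) (base (σ (n + 1) r))) ∧
    (¬ D.CommAt x r q n → base (σ (n + 1) r) = base (σ n r) ∧
      (D.ActsAt x r n → ∃ c, C.LocalStep r (cur (σ n r)) c ∧
        cur (σ (n + 1) r) = rep r (base (σ n r)) c) ∧
      (¬ D.ActsAt x r n → cur (σ (n + 1) r) = cur (σ n r))) := by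
  refine ⟨?_, fun hc => ?_⟩
  · rintro ⟨a, ha, hr, hq⟩
    obtain ⟨t, -, htp⟩ := step_cur ((hσ.2 n).1 a ha)
    obtain ⟨h1, -, h2⟩ := htp r hr
    rw [h1, h2 (dom_ne_of_commAt hleaf hq)]
  · by_cases hact : D.ActsAt x r n
    · obtain ⟨a, ha, hr⟩ := hact
      have hd : D.dom a = {r} := dom_eq_singleton_of_isLeafOf hleaf hr fun hq => hc ⟨a, ha, hr, hq⟩
      obtain ⟨t, ht, htp⟩ := step_cur ((hσ.2 n).1 a ha)
      obtain ⟨h1, h2, -⟩ := htp r hr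
      exact ⟨h2 hd, fun _ => ⟨t r, ht.localStep hd, by rw [h1, h2 hd]⟩,
        fun h => absurd ⟨a, ha, hr⟩ h⟩
    · have := hσ.eq_of_not_actsAt (Nat.le_succ n) fun i h1 h2 => by
        obtain rfl : i = n := by omega
        exact hact
      simp only [Nat.succ_eq_add_one] at this
      rw [this]
      exact ⟨rfl, fun h => absurd h hact, fun _ => rfl⟩

variable {π : ∀ p, C.State p → A.State p} {rank : A.State r → ℕ}

theorem collapse.reach_cur (hσ : (C.collapse rep hrep).IsRun x σ) (hleaf : D.IsLeafOf r q)
    (hg : ∀ b, IsPositional (C.LocalStep r) (π r) b rank (rep r b)) (n : ℕ) :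
    ReflTransGen (C.LocalStep r) (base (σ n r)) (cur (σ n r)) := by
  induction n with
  | zero =>
    rw [hσ.1]
    exact (hg _).reach _ .refl
  | succ n ih =>
    obtain ⟨h1, h2⟩ := run_succ hσ hleaf n
    by_cases hc : D.CommAt x r q n
    · rw [h1 hc]
      exact (hg _).reach _ .refl
    · obtain ⟨hb, h3, h4⟩ := h2 hc
      rw [hb]
      by_cases hact : D.ActsAt x r n
      · obtain ⟨c, hs, hc⟩ := h3 hact
        rw [hc]
        exact (hg _).reach _ (ih.tail hs)
      · rwa [h4 hact]

theorem collapse.base_eq (hσ : (C.collapse rep hrep).IsRun x σ) (hleaf : D.IsLeafOf r q) {l n : ℕ}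
    (hl : ∀ m, l ≤ m → ¬ D.CommAt x r q m) (hn : l ≤ n) : base (σ n r) = base (σ l r) := by
  induction hn with
  | refl => rfl
  | step hn ih => rw [((run_succ hσ hleaf _).2 (hl _ hn)).1, ih]

variable {K : A.Corr}

/-- With infinitely many communications, awareness makes the parity condition independent of the
local paths between the communications. -/
theorem collapse.holds_of_frequently_commAt (hleaf : D.IsLeafOf r q)
    (hparity : K.IsParity r rank) (haware : A.RAware r q rank)
    (hC : A.IsCorrectCovering K C π) (hid : ∀ p, p ≠ r → ∀ b c, rep p b c = c)
    (hg : ∀ b, IsPositional (C.LocalStep r) (π r) b rank (rep r b))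
    (hσ : (C.collapse rep hrep).IsRun x σ) (hmax : (C.collapse rep hrep).IsMaximal x)
    (hτ : A.IsRun x fun n p => π p (cur (σ n p)))
    (hinf : ∃ᶠ n in atTop, D.CommAt x r q n) :
    K.Holds x fun n p => π p (cur (σ n p)) := by
  classical
  -- The simulating `r` waits in its base state until the next communication.
  have hv : ∀ n, ∃ l, (D.CommAt x r q n → C.LocalPath r (base (σ n r)) l (cur (σ n r))) ∧
      (¬ D.CommAt x r q n → C.LocalPath r (base (σ n r)) l (base (σ (n + 1) r))) := by
    intro n
    by_cases hc : D.CommAt x r q n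
    · obtain ⟨l, hl⟩ := exists_localPath (reach_cur hσ hleaf hg n)
      exact ⟨l, fun _ => hl, fun h => absurd hc h⟩
    · refine ⟨[], fun h => absurd h hc, fun _ => ?_⟩
      rw [((run_succ hσ hleaf n).2 hc).1]
      exact .nil _
  choose v hv1 hv2 using hv
  obtain ⟨x', σ', L, S⟩ := exists_simulation hleaf hid hσ (β := fun n => base (σ n r)) (v := v)
    (by rw [hσ.1]; rfl) (fun n h => ⟨rfl, hv1 n h⟩) hv2
  have hlarge := exists_le_of_frequently_lt (hinf.mono fun n hn => by
    rw [S.start_succ_of_commAt hleaf hn]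
    omega) S.mono
  have hinf' : ∃ᶠ i in atTop, D.CommAt x' r q i := by
    rw [frequently_atTop]
    intro k
    obtain ⟨N, hN⟩ := hlarge k
    obtain ⟨n, hn, hc⟩ := frequently_atTop.1 hinf N
    exact ⟨_, (hN.trans (S.mono hn)).trans (Nat.le_add_right _ _),
      (S.commAt_iff hleaf).2 ⟨n, rfl, hc⟩⟩
  have hact' : ∃ᶠ i in atTop, D.ActsAt x' r i := hinf'.mono fun i => actsAt_of_commAt
  have hholds := hC.2 x' σ' S.run (S.isMaximal hσ hmax (.inl hact'))
  have hτ' := hC.1.isRun S.run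
  refine Corr.holds_of_frequently hparity hτ (hinf.mono fun i => actsAt_of_commAt) ?_
    fun p hp => S.holds_of_ne hholds hp
  refine (EvenLimsup.congr fun m => ?_).1 (hholds.evenLimsup hparity hτ' hact')
  obtain ⟨f, hf⟩ := haware
  rw [eventually_rank_le_iff (hf x' _ hτ') hinf', eventually_rank_le_iff (hf x _ hτ) hinf,
    eventually_atTop, eventually_atTop]
  constructor
  · rintro ⟨k, hk⟩
    obtain ⟨N, hN⟩ := hlarge k
    refine ⟨N, fun n hn hc => ?_⟩
    have := hk _ ((hN.trans (S.mono hn)).trans (Nat.le_add_right _ _))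
      ((S.commAt_iff hleaf).2 ⟨n, rfl, hc⟩)
    simp only [S.state_comm n hc] at this
    exact this
  · rintro ⟨N, hN⟩
    refine ⟨L N, fun i hi hc => ?_⟩
    obtain ⟨n, rfl, hcn⟩ := (S.commAt_iff hleaf).1 hc
    simp only [S.state_comm n hcn]
    refine hN n ?_ hcn
    by_contra! hlt
    have h1 := S.start_succ_of_commAt hleaf hcn
    have h2 := S.mono (Nat.succ_le_of_lt hlt)
    simp only [Nat.succ_eq_add_one] at h2
    omega

/-- If `r` stops, then the simulating run takes `r` to the same final state. -/
theorem collapse.holds_of_eventually_not_actsAt (hleaf : D.IsLeafOf r q)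
    (hC : A.IsCorrectCovering K C π) (hid : ∀ p, p ≠ r → ∀ b c, rep p b c = c)
    (hg : ∀ b, IsPositional (C.LocalStep r) (π r) b rank (rep r b))
    (hσ : (C.collapse rep hrep).IsRun x σ) (hmax : (C.collapse rep hrep).IsMaximal x)
    {l : ℕ} (hl : ∀ n, l ≤ n → ¬ D.ActsAt x r n) :
    K.Holds x fun n p => π p (cur (σ n p)) := by
  classical
  -- The path to the final state is inserted at time `l`, even if `r` does not act after its last
  -- communication, since its base state need not be a representative.
  let β : ℕ → C.State r := fun n => if n ≤ l then base (σ n r) else cur (σ l r)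
  have hv : ∀ n, ∃ w, (D.CommAt x r q n →
        β (n + 1) = base (σ (n + 1) r) ∧ C.LocalPath r (β n) w (cur (σ n r))) ∧
      (¬ D.CommAt x r q n → C.LocalPath r (β n) w (β (n + 1))) ∧ (l < n → w = []) := by
    intro n
    rcases lt_trichotomy n l with h | rfl | h
    · have h' : n + 1 ≤ l := h
      simp only [β, if_pos h.le, if_pos h']
      by_cases hc : D.CommAt x r q n
      · obtain ⟨w, hw⟩ := exists_localPath (reach_cur hσ hleaf hg n)
        exact ⟨w, fun _ => ⟨trivial, hw⟩, fun h => absurd hc h, by omega⟩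
      · refine ⟨[], fun h => absurd h hc, fun _ => ?_, by omega⟩
        rw [((run_succ hσ hleaf n).2 hc).1]
        exact .nil _
    · have h' : ¬ n + 1 ≤ n := by omega
      simp only [β, if_pos le_rfl, if_neg h']
      obtain ⟨w, hw⟩ := exists_localPath (reach_cur hσ hleaf hg n)
      exact ⟨w, fun h => absurd (actsAt_of_commAt h) (hl n le_rfl), fun _ => hw, by omega⟩
    · have h1 : ¬ n ≤ l := by omega
      have h2 : ¬ n + 1 ≤ l := by omega
      simp only [β, if_neg h1, if_neg h2]
      exact ⟨[], fun h => absurd (actsAt_of_commAt h) (hl n (by omega)), fun _ => .nil _,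
        fun _ => rfl⟩
  choose v hv1 hv2 hv3 using hv
  obtain ⟨x', σ', L, S⟩ := exists_simulation hleaf hid hσ (β := β) (v := v)
    (by simp only [β, if_pos (Nat.zero_le l), hσ.1]; rfl) hv1 hv2
  have hcur : ∀ n, l ≤ n → σ n r = σ l r := fun n hn =>
    hσ.eq_of_not_actsAt hn fun i hi _ => hl i hi
  have hfin : ∀ n, l + 1 ≤ n → β n = cur (σ n r) := fun n hn => by
    have h1 : ¬ n ≤ l := by omega
    simp only [β, if_neg h1, hcur n (by omega)]
  have hholds := hC.2 x' σ' S.run (S.isMaximal hσ hmax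
    (.inr ⟨l + 1, fun n hn => ⟨hfin n hn, hl n (by omega)⟩⟩))
  intro p
  by_cases hp : p = r
  swap
  · exact S.holds_of_ne hholds hp
  subst hp
  refine ⟨fun n hn => ?_, ?_⟩
  · have h1 := (hholds p).1 (L (l + 1)) (by
      rintro i hi ⟨a, ha, hpa⟩
      rcases S.exists_origin ha with ⟨m, rfl, hm, hd⟩ | ⟨hd, m, h1, h2⟩
      · have h3 := S.start_succ m ⟨a, hm, hd⟩
        have h4 : m < l := by
          by_contra! h
          exact hl m h ⟨a, hm, hpa⟩
        have h5 : L (m + 1) ≤ L (l + 1) := S.mono (by omega)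
        omega
      · have h4 : m ≤ l := by
          by_contra! h
          rw [hv3 m h, List.length_nil] at h2
          omega
        have h5 : L (m + 1) ≤ L (l + 1) := S.mono (by omega)
        have h6 := S.le_succ m
        omega)
    simp only [S.state, Function.update_self, hfin (l + 1) le_rfl, hcur (l + 1) (by omega)] at h1
    have h2 : σ n p = σ l p := by
      rcases le_total n l with h | h
      · exact (hσ.eq_of_not_actsAt h fun i hi _ => hn i hi).symm
      · exact hcur n h
    simp only [h2]
    exact h1
  · rintro t ⟨e, he, hr, -⟩
    have h1 : e l ∈ {n | D.ActsAt x p n} := hr ▸ ⟨l, rfl⟩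
    exact absurd h1 (hl _ (he.id_le l))

/-- If `r` acts infinitely often but communicates only finitely often, then every infinite local
path of `C` from the last base state can be substituted for the last segment of `r`. -/
theorem collapse.holds_of_local (hleaf : D.IsLeafOf r q) (hparity : K.IsParity r rank)
    (hC : A.IsCorrectCovering K C π) (hid : ∀ p, p ≠ r → ∀ b c, rep p b c = c)
    (hg : ∀ b, IsPositional (C.LocalStep r) (π r) b rank (rep r b))
    (hσ : (C.collapse rep hrep).IsRun x σ) (hmax : (C.collapse rep hrep).IsMaximal x)
    (hτ : A.IsRun x fun n p => π p (cur (σ n p)))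
    (hinf : ∃ᶠ n in atTop, D.ActsAt x r n) {l : ℕ} (hl : ∀ n, l ≤ n → ¬ D.CommAt x r q n) :
    K.Holds x fun n p => π p (cur (σ n p)) := by
  classical
  have hinfs : {n | D.ActsAt x r n}.Infinite := Nat.frequently_atTop_iff_infinite.1 hinf
  let cnt := Nat.count (D.ActsAt x r)
  have hsub : ∀ u' : ℕ → C.State r, u' 0 = base (σ l r) →
      (∀ n, C.LocalStep r (u' n) (u' (n + 1))) →
      (∀ p, p ≠ r → (∀ n, (∀ m, n ≤ m → ¬ D.ActsAt x p m) → π p (cur (σ n p)) ∈ K.term p) ∧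
        ∀ t, A.IsProjection x (fun n p => π p (cur (σ n p))) p t → t ∈ K.inf p) ∧
      EvenLimsup fun n => rank (π r (u' n)) := by
    intro u' hu0 hu
    -- From time `l` on, each action of `r` is replaced by one step of the path `u'`.
    let β : ℕ → C.State r := fun n => if n < l then base (σ n r) else u' (cnt n - cnt l)
    have hv : ∀ n, ∃ w, (D.CommAt x r q n →
          β (n + 1) = base (σ (n + 1) r) ∧ C.LocalPath r (β n) w (cur (σ n r))) ∧
        (¬ D.CommAt x r q n → C.LocalPath r (β n) w (β (n + 1))) ∧
        (l ≤ n → D.ActsAt x r n → w.length = 1) ∧ (l ≤ n → ¬ D.ActsAt x r n → w = []) := by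
      intro n
      rcases Nat.lt_or_ge n l with h | h
      · have hβ : β (n + 1) = base (σ (n + 1) r) := by
          rcases Nat.lt_or_ge (n + 1) l with h' | h'
          · simp only [β, if_pos h']
          · obtain rfl : l = n + 1 := by omega
            simp only [β, lt_irrefl, if_false, Nat.sub_self, hu0]
        rw [hβ]
        simp only [β, if_pos h]
        by_cases hc : D.CommAt x r q n
        · obtain ⟨w, hw⟩ := exists_localPath (reach_cur hσ hleaf hg n)
          exact ⟨w, fun _ => ⟨trivial, hw⟩, fun h => absurd hc h, by omega, by omega⟩
        · refine ⟨[], fun h => absurd h hc, fun _ => ?_, by omega, by omega⟩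
          rw [((run_succ hσ hleaf n).2 hc).1]
          exact .nil _
      · have h1 : ¬ n < l := by omega
        have h2 : ¬ n + 1 < l := by omega
        have h3 : cnt l ≤ cnt n := Nat.count_monotone _ h
        have h4 : cnt (n + 1) = cnt n + if D.ActsAt x r n then 1 else 0 := Nat.count_succ _ n
        simp only [β, if_neg h1, if_neg h2]
        by_cases hact : D.ActsAt x r n
        · rw [if_pos hact] at h4
          rw [h4, show cnt n + 1 - cnt l = cnt n - cnt l + 1 by omega]
          obtain ⟨a, ha⟩ := (hu (cnt n - cnt l)).exists_localPath
          exact ⟨[a], fun h' => absurd h' (hl n h), fun _ => ha, fun _ _ => rfl,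
            fun _ h' => absurd hact h'⟩
        · rw [if_neg hact, Nat.add_zero] at h4
          rw [h4]
          exact ⟨[], fun h' => absurd h' (hl n h), fun _ => .nil _, fun _ h' => absurd h' hact,
            fun _ _ => rfl⟩
    choose v hv1 hv2 hv3 hv4 using hv
    have h0 : β 0 = C.init r := by
      rcases Nat.eq_zero_or_pos l with rfl | h
      · simp only [β, lt_irrefl, if_false, Nat.sub_self, hu0, hσ.1]
        rfl
      · simp only [β, if_pos h, hσ.1]
        rfl
    obtain ⟨x', σ', L, S⟩ := exists_simulation hleaf hid hσ (β := β) (v := v) h0 hv1 hv2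
    -- After `l` every block has at most one letter.
    have hlocal : ∀ n, l ≤ n → D.ActsAt x r n → L (n + 1) = L n + 1 := by
      intro n hn hact
      rw [S.start_succ_local n, hv3 n hn hact]
      rintro ⟨a, ha, hd⟩
      obtain ⟨b, hb, hr⟩ := hact
      obtain rfl := Option.some.inj (ha.symm.trans hb)
      exact hd (dom_eq_singleton_of_isLeafOf hleaf hr fun hq => hl n hn ⟨a, ha, hr, hq⟩)
    have hone : ∀ n, l ≤ n → L (n + 1) ≤ L n + 1 := by
      intro n hn
      by_cases hact : D.ActsAt x r n
      · exact (hlocal n hn hact).le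
      · have hvn : (v n).length = 0 := by rw [hv4 n hn hact, List.length_nil]
        by_cases h : ∃ a, x.get? n = some a ∧ D.dom a ≠ {r}
        · rw [S.start_succ n h, hvn]
        · rw [S.start_succ_local n h, hvn]
          omega
    have hlarge := exists_le_of_frequently_lt ((hinf.and_eventually (eventually_ge_atTop l)).mono
      fun n hn => by
        rw [hlocal n hn.2 hn.1]
        omega) S.mono
    have hact' : ∃ᶠ i in atTop, D.ActsAt x' r i := by
      rw [frequently_atTop]
      intro k
      obtain ⟨N, hN⟩ := hlarge k
      obtain ⟨n, hn, hact⟩ := frequently_atTop.1 hinf (max N l)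
      have hvn := hv3 n ((le_max_right _ _).trans hn) hact
      refine ⟨L n, hN.trans (S.mono ((le_max_left _ _).trans hn)), ?_⟩
      have h1 := S.get?_local n 0 (by omega)
      rw [List.getElem?_eq_getElem (by omega)] at h1
      exact ⟨_, h1, by simp [S.dom_local n _ (List.getElem_mem _)]⟩
    have hholds := hC.2 x' σ' S.run (S.isMaximal hσ hmax (.inl hact'))
    refine ⟨fun p hp => S.holds_of_ne hholds hp, ?_⟩
    have hmap : map (fun n => cnt n - cnt l) atTop = atTop := by
      have := map_map (f := (atTop : Filter ℕ)) (m := cnt) (m' := fun k => k - cnt l)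
      rw [map_count_atTop hinfs, map_sub_atTop_eq_nat] at this
      exact this.symm
    rw [← EvenLimsup.comp_iff (s := fun n => rank (π r (u' n))) hmap]
    refine (EvenLimsup.congr fun m => ?_).1 (hholds.evenLimsup hparity (hC.1.isRun S.run) hact')
    have hst : ∀ n, l ≤ n → σ' (L n) r = u' (cnt n - cnt l) := fun n hn => by
      rw [S.state, Function.update_self]
      simp only [β, if_neg (Nat.not_lt.2 hn)]
    rw [eventually_atTop, eventually_atTop]
    constructor
    · rintro ⟨k, hk⟩
      obtain ⟨N, hN⟩ := hlarge k
      refine ⟨max N l, fun n hn => ?_⟩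
      rw [← hst n ((le_max_right _ _).trans hn)]
      exact hk _ (hN.trans (S.mono ((le_max_left _ _).trans hn)))
    · rintro ⟨N, hN⟩
      refine ⟨L (max N l), fun i hi => ?_⟩
      obtain ⟨k, hk⟩ := hlarge (i + 1)
      obtain ⟨n, h1, h2⟩ := S.exists_block (i := i) (n := k) (by omega)
      have h3 : max N l ≤ n := by
        by_contra! h
        have := S.mono (Nat.succ_le_of_lt h)
        simp only [Nat.succ_eq_add_one] at this
        omega
      have h4 := hone n ((le_max_right _ _).trans h3)
      obtain rfl : i = L n := by omega
      rw [hst n ((le_max_right _ _).trans h3)]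
      exact hN n ((le_max_left _ _).trans h3)
  -- The states of `r` in the last segment form a path through representatives.
  let e := Nat.nth (D.ActsAt x r)
  have he : StrictMono e := Nat.nth_strictMono hinfs
  let u : ℕ → C.State r := fun k => cur (σ (e (k + cnt l)) r)
  have hel : ∀ k, l ≤ e (k + cnt l) := fun k =>
    ((Nat.count_le_iff_le_nth hinfs).1 le_rfl).trans (he.monotone (Nat.le_add_left _ _))
  have hbase : ∀ k, base (σ (e (k + cnt l)) r) = base (σ l r) := fun k =>
    base_eq hσ hleaf hl (hel k)
  have hu0 : ReflTransGen (C.LocalStep r) (base (σ l r)) (u 0) := by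
    rw [← hbase 0]
    exact reach_cur hσ hleaf hg _
  have hu : ∀ k, ∃ c, C.LocalStep r (u k) c ∧ u (k + 1) = rep r (base (σ l r)) c := by
    intro k
    obtain ⟨c, hs, hc⟩ := ((run_succ hσ hleaf _).2 (hl _ (hel k))).2.1
      (Nat.nth_mem_of_infinite hinfs _)
    refine ⟨c, hs, ?_⟩
    rw [hbase k] at hc
    rw [← hc]
    refine congrArg cur (hσ.eq_of_not_actsAt
      (he (show k + cnt l < k + 1 + cnt l by omega)) fun i h1 h2 hi => ?_)
    have h3 : i ≤ e (k + cnt l) := Nat.le_nth_of_lt_nth_succ (by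
      rwa [show k + cnt l + 1 = k + 1 + cnt l by omega]) hi
    omega
  obtain ⟨u', hu0', hu'⟩ := (hg (base (σ l r))).exists_path u hu0 hu
  refine Corr.holds_of_frequently hparity hτ hinf ?_ (hsub u' hu0' hu').1
  have hpar := (hg (base (σ l r))).evenLimsup u hu0 hu fun u' h0 h => (hsub u' h0 h).2
  have := (EvenLimsup.shift_iff (fun k => rank (π r (cur (σ (e k) r)))) (cnt l)).1 hpar
  exact (hτ.evenLimsup_projection_iff he (Nat.range_nth_of_infinite hinfs) rank).1 this

theorem collapse.isCorrectCovering (hleaf : D.IsLeafOf r q)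
    (hparity : K.IsParity r rank) (haware : A.RAware r q rank)
    (hC : A.IsCorrectCovering K C π) (hid : ∀ p, p ≠ r → ∀ b c, rep p b c = c)
    (hg : ∀ b, IsPositional (C.LocalStep r) (π r) b rank (rep r b)) :
    A.IsCorrectCovering K (C.collapse rep hrep) fun p s => π p (cur s) := by
  have hcov : A.IsCovering (C.collapse rep hrep) fun p s => π p (cur s) :=
    isCovering hC.1 fun p b c => by
      by_cases hp : p = r
      · subst hp
        exact (hg b).map_eq c
      · rw [hid p hp]
  refine ⟨hcov, fun x σ hσ hmax => ?_⟩
  have hτ := hcov.isRun hσ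
  by_cases hcomm : ∃ᶠ n in atTop, D.CommAt x r q n
  · exact holds_of_frequently_commAt hleaf hparity haware hC hid hg hσ hmax hτ hcomm
  obtain ⟨l, hl⟩ := eventually_atTop.1 (not_frequently.1 hcomm)
  by_cases hact : ∃ᶠ n in atTop, D.ActsAt x r n
  · exact holds_of_local hleaf hparity hC hid hg hσ hmax hτ hact hl
  · obtain ⟨l, hl⟩ := eventually_atTop.1 (not_frequently.1 hact)
    exact holds_of_eventually_not_actsAt hleaf hC hid hg hσ hmax hl

end Correctness

end ZielonkaAutomaton

theorem mainTheorem4 {P : Type v} {Act : Type w} [Finite P] [Finite Act]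
    (D : DistAlphabet P Act) (r q : P) (hleaf : D.IsLeafOf r q)
    (A : ZielonkaAutomaton.{u} D) (K : A.Corr) (rank : A.State r → ℕ)
    (hparity : K.IsParity r rank) (haware : A.RAware r q rank)
    (hcontroller : ∃ C : ZielonkaAutomaton.{u} D, A.IsCorrectController K C) :
    ∃ (C : ZielonkaAutomaton.{u} D) (π : ∀ p, C.State p → A.State p),
      A.IsCorrectCovering K C π ∧ A.RMemoryless C π r := by
  classical
  obtain ⟨C, hC⟩ := hcontroller
  have hcov := hC.isCorrectCovering
  have hfin := (A.prod C).finite_state r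
  choose g hg using fun b => exists_isPositional ((A.prod C).LocalStep r) Prod.fst b rank
  let rep : ∀ p, (A.prod C).State p → (A.prod C).State p → (A.prod C).State p :=
    Function.update (fun _ _ c => c) r g
  have hr : rep r = g := Function.update_self _ _ _
  have hid : ∀ p, p ≠ r → ∀ b c, rep p b c = c := fun p hp b c => by
    simp only [rep, Function.update_of_ne hp]
  have hg' : ∀ b, IsPositional ((A.prod C).LocalStep r) Prod.fst b rank (rep r b) := hr ▸ hg
  have hrep : ∀ p b c, rep p b (rep p b c) = rep p b c := fun p b c => by
    by_cases hp : p = r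
    · subst hp
      exact (hg' b).congr _ _ ((hg' b).map_eq c)
    · rw [hid p hp, hid p hp]
  exact ⟨(A.prod C).collapse rep hrep, fun _ s => (ZielonkaAutomaton.collapse.cur s).1,
    ZielonkaAutomaton.collapse.isCorrectCovering hleaf hparity haware hcov hid hg',
    ZielonkaAutomaton.collapse.rMemoryless (π := fun _ => Prod.fst) fun b => (hg' b).congr⟩
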